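/- Let $\kappa<0$ and let $\mathbb H^2(\kappa)\times\mathbb R$ be the product of the hyperbolic plane of curvature $\kappa$ with the line, in the model $\{x^2+y^2<-4/\kappa\}\times\mathbb R$ with metric $\sigma^2(dx^2+dy^2)+dz^2$, $\sigma=4/(4+\kappa(x^2+y^2))$. Let $I\subset\mathbb R$ be an open interval and let $\alpha:I\to\mathbb H^2(\kappa)$ be a smooth regular curve of constant geodesic curvature $\kappa_g$ with $\kappa_g^2+\kappa\le 0$ (so $\alpha$ is part or all of a geodesic, an equidistant curve or a horocycle). For $L>0$ let $\Sigma=C_\alpha(L)=\{(x,y,z):(x,y)\in\alpha(I),\ 0\le z\le L\}$ be the part of the vertical cylinder over $\alpha$ between the planes $\Pi_0=\{z=0\}$ and $\Pi_L=\{z=L\}$, with the unit normal $N=\alpha'\times\partial_z/|\alpha'|$. Then $\Sigma$ is strongly stable in the partitioning problem with support $\Pi_0\cup\Pi_L$, which means the following. (1) $\Sigma$ is capillary: it has constant mean curvature $H$ (half of the trace of the second fundamental form $A$ for $N$), and it meets both planes under a constant contact angle $\gamma\in(0,\pi)$, $\cos\gamma=\langle N,\widetilde N\rangle$, where $\widetilde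 N$ is the unit normal of the planes pointing out of the slab $0<z<L$. (2) Let $(\Sigma_t)_{|t|<\varepsilon}$ be any admissible variation of $\Sigma$, that is, a smooth variation $\Sigma_0=\Sigma$ that moves only points over a compact interval $[a,b]\subset I$, keeps the interior of $\Sigma_t$ in the slab and keeps each edge of $\Sigma_t$ in its plane. Let $J(t)=\mathrm{Area}(\Sigma_t)-\cos\gamma\,\mathrm{Area}(\Omega(t))+2H\,V(t)$, where the first term is the area of the part over $[a,b]$, $\mathrm{Area}(\Omega(t))$ is the area of the region of $\Pi_0\cup\Pi_L$ bounded by $\partial\Sigma_t$ on the side into which $N$ points (up to an additive constant) and $V(t)$ is the signed volume swept from $\Sigma_0$ to $\Sigma_t$ (positive for motion along $N$). Then $J$ is of class $C^2$ near $0$, $J'(0)=0$ and $J''(0)\ge 0$. (No volume constraint is imposed; if the variation preserves the volume then $J$ is the energy $\mathrm{Area}(\Sigma_t)-\cos\gamma\,\mathrm{Area}(\Omega(t))$.) (3) For every smooth compactly supported function $u$ on $\Sigma$, not necessarily zero on $\partial\Sigma$, $$-\int_\Sigma u\,\bigl(\Delta u+|A|^2u+\mathrm{Ric}(N)\,u\bigr)+\int_{\partial\Sigma}u\Bigl(\frac{\partial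 u}{\partial\nu}-\mathbf q\,u\Bigr)\ \ge\ 0,\qquad \mathbf q=\frac{1}{\sin\gamma}\widetilde A(\widetilde\nu,\widetilde\nu)+\frac{\cos\gamma}{\sin\gamma}A(\nu,\nu),$$ where $\mathrm{Ric}$ is the Ricci curvature of $\mathbb H^2(\kappa)\times\mathbb R$, $\widetilde A$ is the second fundamental form of the planes with respect to $-\widetilde N$, and $\nu$, $\widetilde\nu$ are the exterior unit conormals of $\partial\Sigma$ in $\Sigma$ and in $\Omega(0)$. -/

import Mathlib

open scoped ContDiff Matrix

noncomputable section

namespace Partitioning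

/-! ## Riemannian geometry in coordinates -/

/-- The `i`-th partial derivative of a map defined on a coordinate space. -/
def pd {ι E : Type} [Fintype ι] [DecidableEq ι] [NormedAddCommGroup E] [NormedSpace ℝ E]
    (i : ι) (f : (ι → ℝ) → E) (p : ι → ℝ) : E :=
  fderiv ℝ f p (Pi.single i 1)

/-- The scalar product of two tangent vectors at `p` for the metric with matrix `g p`. -/
def ip {ι : Type} [Fintype ι] (g : (ι → ℝ) → Matrix ι ι ℝ) (p v w : ι → ℝ) : ℝ :=
  v ⬝ᵥ (g p *ᵥ w)

/-- The Christoffel symbol `Γ^k_{ij}` of the Levi-Civita connection of `g`. -/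
def christoffel {ι : Type} [Fintype ι] [DecidableEq ι] (g : (ι → ℝ) → Matrix ι ι ℝ)
    (k i j : ι) (p : ι → ℝ) : ℝ :=
  (1 / 2) * ∑ l, (g p)⁻¹ k l *
    (pd i (fun x => g x j l) p + pd j (fun x => g x i l) p - pd l (fun x => g x i j) p)

/-- The component `Ric_{ij}` of the Ricci tensor of `g` (nonnegative on round spheres). -/
def ricciTensor {ι : Type} [Fintype ι] [DecidableEq ι] (g : (ι → ℝ) → Matrix ι ι ℝ)
    (i j : ι) (p : ι → ℝ) : ℝ :=
  ∑ k, (pd k (christoffel g k i j) p - pd j (christoffel g k i k) p) +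
    ∑ k, ∑ l, (christoffel g k k l p * christoffel g l i j p -
      christoffel g k j l p * christoffel g l i k p)

/-- `Ric(v) = Ric(v, v)` at the point `p`. -/
def ric {ι : Type} [Fintype ι] [DecidableEq ι] (g : (ι → ℝ) → Matrix ι ι ℝ)
    (p v : ι → ℝ) : ℝ :=
  ∑ i, ∑ j, ricciTensor g i j p * v i * v j

/-! ## Parametrized surfaces in a coordinate domain of dimension three -/

/-- The first fundamental form of the parametrized surface `ψ`. -/
def firstFF (g : (Fin 3 → ℝ) → Matrix (Fin 3) (Fin 3) ℝ) (ψ : (Fin 2 → ℝ) → Fin 3 → ℝ)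
    (q : Fin 2 → ℝ) : Matrix (Fin 2) (Fin 2) ℝ :=
  Matrix.of fun i j => ip g (ψ q) (pd i ψ q) (pd j ψ q)

/-- The area density of `ψ`. -/
def areaDensity (g : (Fin 3 → ℝ) → Matrix (Fin 3) (Fin 3) ℝ) (ψ : (Fin 2 → ℝ) → Fin 3 → ℝ)
    (q : Fin 2 → ℝ) : ℝ :=
  √(firstFF g ψ q).det

/-- The unit normal of `ψ`: the Riemannian cross product of the two coordinate vectors,
normalized. -/
def unitNormal (g : (Fin 3 → ℝ) → Matrix (Fin 3) (Fin 3) ℝ) (ψ : (Fin 2 → ℝ) → Fin 3 → ℝ)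
    (q : Fin 2 → ℝ) : Fin 3 → ℝ :=
  let n : Fin 3 → ℝ := (g (ψ q))⁻¹ *ᵥ (crossProduct (pd 0 ψ q) (pd 1 ψ q))
  (√(ip g (ψ q) n n))⁻¹ • n

/-- The covariant derivative, in the `i`-th coordinate direction, of a vector field `V`
along `ψ`. -/
def covDeriv (g : (Fin 3 → ℝ) → Matrix (Fin 3) (Fin 3) ℝ) (ψ V : (Fin 2 → ℝ) → Fin 3 → ℝ)
    (i : Fin 2) (q : Fin 2 → ℝ) : Fin 3 → ℝ :=
  fun k => pd i V q k + ∑ a, ∑ b, christoffel g k a b (ψ q) * pd i ψ q a * V q b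

/-- The second fundamental form of `ψ` with respect to `unitNormal`. -/
def secondFF (g : (Fin 3 → ℝ) → Matrix (Fin 3) (Fin 3) ℝ) (ψ : (Fin 2 → ℝ) → Fin 3 → ℝ)
    (q : Fin 2 → ℝ) (i j : Fin 2) : ℝ :=
  ip g (ψ q) (covDeriv g ψ (pd j ψ) i q) (unitNormal g ψ q)

/-- The mean curvature, that is, half of the trace of the second fundamental form. -/
def meanCurvature (g : (Fin 3 → ℝ) → Matrix (Fin 3) (Fin 3) ℝ) (ψ : (Fin 2 → ℝ) → Fin 3 → ℝ)
    (q : Fin 2 → ℝ) : ℝ :=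
  (1 / 2) * ∑ i, ∑ j, (firstFF g ψ q)⁻¹ i j * secondFF g ψ q i j

/-- The squared norm `|A|²` of the second fundamental form. -/
def normSqSecondFF (g : (Fin 3 → ℝ) → Matrix (Fin 3) (Fin 3) ℝ)
    (ψ : (Fin 2 → ℝ) → Fin 3 → ℝ) (q : Fin 2 → ℝ) : ℝ :=
  ∑ i, ∑ j, ∑ k, ∑ l, (firstFF g ψ q)⁻¹ i k * (firstFF g ψ q)⁻¹ j l *
    secondFF g ψ q i j * secondFF g ψ q k l

/-- The Laplace-Beltrami operator of the surface `ψ`. -/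
def laplacian (g : (Fin 3 → ℝ) → Matrix (Fin 3) (Fin 3) ℝ) (ψ : (Fin 2 → ℝ) → Fin 3 → ℝ)
    (u : (Fin 2 → ℝ) → ℝ) (q : Fin 2 → ℝ) : ℝ :=
  (areaDensity g ψ q)⁻¹ *
    ∑ i, pd i (fun x => areaDensity g ψ x * ∑ j, (firstFF g ψ x)⁻¹ i j * pd j u x) q

/-- The Jacobi operator `Δ + |A|² + Ric(N)`. -/
def jacobi (g : (Fin 3 → ℝ) → Matrix (Fin 3) (Fin 3) ℝ) (ψ : (Fin 2 → ℝ) → Fin 3 → ℝ)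
    (u : (Fin 2 → ℝ) → ℝ) (q : Fin 2 → ℝ) : ℝ :=
  laplacian g ψ u q + normSqSecondFF g ψ q * u q + ric g (ψ q) (unitNormal g ψ q) * u q

/-! ## Surfaces in a slab, with boundary on the two bounding planes

The surface is parametrized by the strip `I × [0, L]` and its boundary consists of the two edges
`I × {0}` and `I × {L}`, which lie in the planes `z = 0` and `z = L`.  At the edge `I × {c}` the
direction pointing out of the strip, and out of the slab, is the one of the sign `e` times the
second coordinate: `e = -1` for `c = 0` and `e = 1` for `c = L`. -/

/-- The plane `z = c`. -/
def plane (c : ℝ) (p : Fin 2 → ℝ) : Fin 3 → ℝ := ![p 0, p 1, c]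

/-- The point `(x, y)` for which `plane c` passes through the boundary point `ψ (s, c)`. -/
def footPoint (ψ : (Fin 2 → ℝ) → Fin 3 → ℝ) (c s : ℝ) : Fin 2 → ℝ :=
  ![ψ ![s, c] 0, ψ ![s, c] 1]

/-- The unit normal of the plane `z = c`, pointing out of the slab, at `ψ (s, c)`. -/
def supportNormal (g : (Fin 3 → ℝ) → Matrix (Fin 3) (Fin 3) ℝ)
    (ψ : (Fin 2 → ℝ) → Fin 3 → ℝ) (e c s : ℝ) : Fin 3 → ℝ :=
  e • unitNormal g (plane c) (footPoint ψ c s)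

/-- The cosine of the angle between the unit normals of surface and support at `ψ (s, c)`. -/
def contactCos (g : (Fin 3 → ℝ) → Matrix (Fin 3) (Fin 3) ℝ)
    (ψ : (Fin 2 → ℝ) → Fin 3 → ℝ) (e c s : ℝ) : ℝ :=
  ip g (ψ ![s, c]) (unitNormal g ψ ![s, c]) (supportNormal g ψ e c s)

/-- The exterior unit conormal `ν` of the surface along its boundary, in the basis of the
coordinate vectors of `ψ`: it is orthogonal to the edge and points out of the strip. -/
def conormal (g : (Fin 3 → ℝ) → Matrix (Fin 3) (Fin 3) ℝ)
    (ψ : (Fin 2 → ℝ) → Fin 3 → ℝ) (e c s : ℝ) : Fin 2 → ℝ :=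
  fun i => e * (firstFF g ψ ![s, c])⁻¹ i 1 / √((firstFF g ψ ![s, c])⁻¹ 1 1)

/-- The derivative of `u` in the direction of the exterior conormal. -/
def conormalDeriv (g : (Fin 3 → ℝ) → Matrix (Fin 3) (Fin 3) ℝ)
    (ψ : (Fin 2 → ℝ) → Fin 3 → ℝ) (u : (Fin 2 → ℝ) → ℝ) (e c s : ℝ) : ℝ :=
  ∑ i, conormal g ψ e c s i * pd i u ![s, c]

/-- The exterior unit conormal of the boundary curve in the supporting plane: the normalized
projection to that plane of minus the unit normal of the surface (the normal of the surface
points into the enclosed domain). -/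
def supportConormal (g : (Fin 3 → ℝ) → Matrix (Fin 3) (Fin 3) ℝ)
    (ψ : (Fin 2 → ℝ) → Fin 3 → ℝ) (e c s : ℝ) : Fin 3 → ℝ :=
  let v : Fin 3 → ℝ :=
    contactCos g ψ e c s • supportNormal g ψ e c s - unitNormal g ψ ![s, c]
  (√(ip g (ψ ![s, c]) v v))⁻¹ • v

/-- The coefficient `q = Ã(ν̃, ν̃) / sin γ + (cos γ / sin γ) A(ν, ν)` of the boundary term, where
`Ã` is the second fundamental form of the support for its normal pointing into the slab. -/
def robinCoeff (g : (Fin 3 → ℝ) → Matrix (Fin 3) (Fin 3) ℝ)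
    (ψ : (Fin 2 → ℝ) → Fin 3 → ℝ) (γ e c s : ℝ) : ℝ :=
  (1 / Real.sin γ) *
      (∑ i : Fin 2, ∑ j : Fin 2, -e * secondFF g (plane c) (footPoint ψ c s) i j *
        supportConormal g ψ e c s i.castSucc * supportConormal g ψ e c s j.castSucc) +
    (Real.cos γ / Real.sin γ) *
      (∑ i, ∑ j, secondFF g ψ ![s, c] i j * conormal g ψ e c s i * conormal g ψ e c s j)

/-- The boundary integral of `u (∂u/∂ν - q u)` over the edge `I × {c}`. -/
def edgeTerm (g : (Fin 3 → ℝ) → Matrix (Fin 3) (Fin 3) ℝ) (ψ : (Fin 2 → ℝ) → Fin 3 → ℝ)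
    (I : Set ℝ) (γ : ℝ) (u : (Fin 2 → ℝ) → ℝ) (e c : ℝ) : ℝ :=
  ∫ s in I, u ![s, c] * (conormalDeriv g ψ u e c s - robinCoeff g ψ γ e c s * u ![s, c]) *
    √(firstFF g ψ ![s, c] 0 0)

/-- The quadratic form `-∫_Σ u (Δu + |A|² u + Ric(N) u) + ∫_{∂Σ} u (∂u/∂ν - q u)` of the second
variation, for the surface `ψ` on `I × [0, L]` with contact angle `γ`. -/
def secondVariation (g : (Fin 3 → ℝ) → Matrix (Fin 3) (Fin 3) ℝ)
    (ψ : (Fin 2 → ℝ) → Fin 3 → ℝ) (I : Set ℝ) (L γ : ℝ) (u : (Fin 2 → ℝ) → ℝ) : ℝ :=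
  -(∫ s in I, ∫ z in (0 : ℝ)..L, u ![s, z] * jacobi g ψ u ![s, z] * areaDensity g ψ ![s, z]) +
    (edgeTerm g ψ I γ u (-1) 0 + edgeTerm g ψ I γ u 1 L)

/-- Smooth functions on `I × [0, L]` with compact support, given by a smooth extension to the
plane.  They need not vanish on the edges. -/
structure IsTestFunction (I : Set ℝ) (u : (Fin 2 → ℝ) → ℝ) : Prop where
  smooth : ContDiff ℝ ∞ u
  support : ∃ a b : ℝ, Set.Icc a b ⊆ I ∧ ∀ q : Fin 2 → ℝ, q 0 ∉ Set.Icc a b → u q = 0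

/-- The surface `ψ` on `I × [0, L]` is capillary in the slab: its mean curvature is the constant
`H` and it meets both planes under the constant angle `γ`. -/
structure IsCapillary (g : (Fin 3 → ℝ) → Matrix (Fin 3) (Fin 3) ℝ)
    (ψ : (Fin 2 → ℝ) → Fin 3 → ℝ) (I : Set ℝ) (L H γ : ℝ) : Prop where
  cmc : ∀ s ∈ I, ∀ z ∈ Set.Icc 0 L, meanCurvature g ψ ![s, z] = H
  angle_mem : γ ∈ Set.Ioo 0 Real.pi
  angle_bottom : ∀ s ∈ I, contactCos g ψ (-1) 0 s = Real.cos γ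
  angle_top : ∀ s ∈ I, contactCos g ψ 1 L s = Real.cos γ

/-- `Ψ t`, `|t| < ε`, is an admissible variation of `ψ` in the part `0 ≤ z ≤ L` of the domain
`U`: it is smooth, it moves only points over the compact interval `[a, b] ⊆ I`, interior points
stay between the planes and boundary points stay in the planes. -/
structure IsAdmissibleVariation (U : Set (Fin 3 → ℝ)) (ψ : (Fin 2 → ℝ) → Fin 3 → ℝ)
    (I : Set ℝ) (L ε a b : ℝ) (Ψ : ℝ → (Fin 2 → ℝ) → Fin 3 → ℝ) : Prop where
  pos : 0 < ε
  le : a ≤ b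
  subset : Set.Icc a b ⊆ I
  smooth : ContDiffOn ℝ ∞ (fun x : ℝ × (Fin 2 → ℝ) => Ψ x.1 x.2)
    (Set.Ioo (-ε) ε ×ˢ {q | q 0 ∈ I})
  mem : ∀ t ∈ Set.Ioo (-ε) ε, ∀ s ∈ I, ∀ z ∈ Set.Icc 0 L, Ψ t ![s, z] ∈ U
  initial : ∀ s ∈ I, ∀ z ∈ Set.Icc 0 L, Ψ 0 ![s, z] = ψ ![s, z]
  support : ∀ t ∈ Set.Ioo (-ε) ε, ∀ s ∈ I, s ∉ Set.Icc a b → ∀ z ∈ Set.Icc 0 L,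
    Ψ t ![s, z] = ψ ![s, z]
  interior : ∀ t ∈ Set.Ioo (-ε) ε, ∀ s ∈ I, ∀ z ∈ Set.Ioo 0 L, Ψ t ![s, z] 2 ∈ Set.Ioo 0 L
  bottom : ∀ t ∈ Set.Ioo (-ε) ε, ∀ s ∈ I, Ψ t ![s, 0] 2 = 0
  top : ∀ t ∈ Set.Ioo (-ε) ε, ∀ s ∈ I, Ψ t ![s, L] 2 = L

/-- The area of the part of `ψ` over `[a, b] × [0, L]`. -/
def area (g : (Fin 3 → ℝ) → Matrix (Fin 3) (Fin 3) ℝ) (ψ : (Fin 2 → ℝ) → Fin 3 → ℝ)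
    (L a b : ℝ) : ℝ :=
  ∫ s in a..b, ∫ z in (0 : ℝ)..L, areaDensity g ψ ![s, z]

/-- The signed volume swept by the variation between the times `0` and `t`, counted positively
for a motion in the direction of the unit normal. -/
def sweptVolume (g : (Fin 3 → ℝ) → Matrix (Fin 3) (Fin 3) ℝ)
    (Ψ : ℝ → (Fin 2 → ℝ) → Fin 3 → ℝ) (L a b t : ℝ) : ℝ :=
  ∫ r in (0 : ℝ)..t, ∫ s in a..b, ∫ z in (0 : ℝ)..L,
    √(g (Ψ r ![s, z])).det *
      (deriv (fun x => Ψ x ![s, z]) r ⬝ᵥ crossProduct (pd 0 (Ψ r) ![s, z]) (pd 1 (Ψ r) ![s, z]))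

/-- The signed area of the plane `z = c` swept by the edge `I × {c}` between the times `0` and
`t`, counted positively for a motion in the direction of the unit normal of the surface. -/
def sweptPlaneArea (g : (Fin 3 → ℝ) → Matrix (Fin 3) (Fin 3) ℝ)
    (Ψ : ℝ → (Fin 2 → ℝ) → Fin 3 → ℝ) (c a b t : ℝ) : ℝ :=
  ∫ r in (0 : ℝ)..t, ∫ s in a..b, areaDensity g (plane c) (footPoint (Ψ r) c s) *
    (deriv (fun x => Ψ x ![s, c]) r 0 * pd 0 (Ψ r) ![s, c] 1 -
      deriv (fun x => Ψ x ![s, c]) r 1 * pd 0 (Ψ r) ![s, c] 0)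

/-- The energy `Area(Σ_t) - cos γ · Area(Ω(t))`, up to an additive constant.  The normal points
into the enclosed domain, so the area of the wetted domain `Ω(t)` is its initial value minus the
swept areas. -/
def energy (g : (Fin 3 → ℝ) → Matrix (Fin 3) (Fin 3) ℝ)
    (Ψ : ℝ → (Fin 2 → ℝ) → Fin 3 → ℝ) (L γ a b t : ℝ) : ℝ :=
  area g (Ψ t) L a b -
    Real.cos γ * (-(sweptPlaneArea g Ψ 0 a b t + sweptPlaneArea g Ψ L a b t))

/-- The energy with the volume as Lagrange multiplier term.  It equals the energy along variations
that preserve the volume, and it makes the second variation without volume constraint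
meaningful. -/
def constrainedEnergy (g : (Fin 3 → ℝ) → Matrix (Fin 3) (Fin 3) ℝ)
    (Ψ : ℝ → (Fin 2 → ℝ) → Fin 3 → ℝ) (L H γ a b t : ℝ) : ℝ :=
  energy g Ψ L γ a b t + 2 * H * sweptVolume g Ψ L a b t

/-- The surface `ψ` on `I × [0, L]` in the part `0 ≤ z ≤ L` of the domain `U` is strongly stable in
the partitioning problem: it is capillary, the energy has vanishing first and nonnegative second
derivative along all admissible variations, whether they preserve the volume or not, and the
quadratic form of the second variation is nonnegative on all test functions. -/
def IsStronglyStable (U : Set (Fin 3 → ℝ)) (g : (Fin 3 → ℝ) → Matrix (Fin 3) (Fin 3) ℝ)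
    (ψ : (Fin 2 → ℝ) → Fin 3 → ℝ) (I : Set ℝ) (L : ℝ) : Prop :=
  ∃ H γ : ℝ, IsCapillary g ψ I L H γ ∧
    (∀ (ε a b : ℝ) (Ψ : ℝ → (Fin 2 → ℝ) → Fin 3 → ℝ),
      IsAdmissibleVariation U ψ I L ε a b Ψ →
        ContDiffAt ℝ 2 (constrainedEnergy g Ψ L H γ a b) 0 ∧
        deriv (constrainedEnergy g Ψ L H γ a b) 0 = 0 ∧
        0 ≤ deriv (deriv (constrainedEnergy g Ψ L H γ a b)) 0) ∧
    ∀ u : (Fin 2 → ℝ) → ℝ, IsTestFunction I u → 0 ≤ secondVariation g ψ I L γ u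

/-! ## The space `ℍ²(κ) × ℝ` and its vertical cylinders -/

/-- The conformal factor. -/
def conf (κ x y : ℝ) : ℝ := 4 / (4 + κ * (x ^ 2 + y ^ 2))

/-- The disk model of `ℍ²(κ)`, `κ < 0`. -/
def disk (κ : ℝ) : Set (Fin 2 → ℝ) := {p | p 0 ^ 2 + p 1 ^ 2 < (2 / √(-κ)) ^ 2}

/-- The metric `σ² (dx² + dy²)` of `ℍ²(κ)`. -/
def metricH (κ : ℝ) (p : Fin 2 → ℝ) : Matrix (Fin 2) (Fin 2) ℝ :=
  Matrix.diagonal ![conf κ (p 0) (p 1) ^ 2, conf κ (p 0) (p 1) ^ 2]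

/-- The model `𝔻(2/√(-κ)) × ℝ` of `ℍ²(κ) × ℝ`. -/
def space (κ : ℝ) : Set (Fin 3 → ℝ) := {p | ![p 0, p 1] ∈ disk κ}

/-- The metric `σ² (dx² + dy²) + dz²` of `ℍ²(κ) × ℝ`. -/
def metricHR (κ : ℝ) (p : Fin 3 → ℝ) : Matrix (Fin 3) (Fin 3) ℝ :=
  Matrix.diagonal ![conf κ (p 0) (p 1) ^ 2, conf κ (p 0) (p 1) ^ 2, 1]

/-- The acceleration `∇_{α'} α'` of a curve in `ℍ²(κ)`. -/
def accel (κ : ℝ) (α : ℝ → Fin 2 → ℝ) (s : ℝ) : Fin 2 → ℝ :=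
  fun k => deriv (deriv α) s k +
    ∑ i, ∑ j, christoffel (metricH κ) k i j (α s) * deriv α s i * deriv α s j

/-- The geodesic curvature of a regular curve in `ℍ²(κ)`, with respect to the normal obtained from
`α'` by a rotation of `π / 2`. -/
def geodesicCurvature (κ : ℝ) (α : ℝ → Fin 2 → ℝ) (s : ℝ) : ℝ :=
  ip (metricH κ) (α s) (accel κ α s) ![-deriv α s 1, deriv α s 0] /
    √(ip (metricH κ) (α s) (deriv α s) (deriv α s)) ^ 3

/-- The parametrization `(s, z) ↦ (α s, z)` of the vertical cylinder over `α`. -/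
def cylinder (α : ℝ → Fin 2 → ℝ) (q : Fin 2 → ℝ) : Fin 3 → ℝ :=
  ![α (q 0) 0, α (q 0) 1, q 1]

/-- The part between `z = 0` and `z = L` of the vertical cylinder `π⁻¹(α(I))`. -/
def truncatedCylinder (I : Set ℝ) (α : ℝ → Fin 2 → ℝ) (L : ℝ) : Set (Fin 3 → ℝ) :=
  {p | ![p 0, p 1] ∈ α '' I ∧ 0 ≤ p 2 ∧ p 2 ≤ L}

theorem cylinder_image (I : Set ℝ) (α : ℝ → Fin 2 → ℝ) (L : ℝ) :
    cylinder α '' {q | q 0 ∈ I ∧ q 1 ∈ Set.Icc 0 L} = truncatedCylinder I α L := by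
  ext p
  constructor
  · rintro ⟨q, ⟨hq, hz⟩, rfl⟩
    refine ⟨⟨q 0, hq, ?_⟩, hz.1, hz.2⟩
    ext i
    fin_cases i <;> rfl
  · rintro ⟨⟨s, hs, h⟩, h0, hL⟩
    refine ⟨![s, p 2], ⟨hs, h0, hL⟩, ?_⟩
    ext i
    fin_cases i
    · simpa [cylinder] using congrFun h 0
    · simpa [cylinder] using congrFun h 1
    · rfl

end Partitioning

end

/-! The surface stands orthogonally on the planes, because its normal is horizontal. So γ = π/2, the
wetted areas drop out of the energy, and J(t) = Area(Σ_t) − κ_g V(t), with 2H = −κ_g. The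
variational statement and the quadratic form are treated independently.

Variations: the cylinder is calibrated. A curve with κ_g² + κ ≤ 0 runs to an ideal point ξ
(`exists_idealPoint`; this is where the bound enters), and it is a leaf of the foliation of ℍ² by
lines meeting the geodesics through ξ under a fixed angle. The unit normal field of this foliation
is invariant under the isometries fixing ξ. These act transitively, so its divergence is constant,
equal to κ_g (`divergence_idealField`, `exists_calibration`). Extend the field horizontally to ℍ² ×
ℝ and let F(t) be its flux through Σ_t. Horizontality prevents flux through the planes and the ends
of Σ_t are fixed, so the divergence theorem gives F(t) = F(0) + κ_g V(t) (`flux_eq`). By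
Cauchy–Schwarz F(t) ≤ Area(Σ_t), with equality at t = 0 (`flux_le_areaDensity`). Hence J(t) ≥ F(t) −
κ_g V(t) = F(0) = J(0): J has a minimum at 0, whence J'(0) = 0 and J''(0) ≥ 0 (`variation_stable`).

Quadratic form: on the cylinder |A|² + Ric(N) = κ_g² + κ is constant and 𝐪 = 0, since the planes are
totally geodesic and cos γ = 0. Green's formula cancels the boundary integral and leaves ∫ |∇u|² −
(κ_g² + κ) u² ≥ 0 (`secondVariation_cylinder_nonneg`). -/

namespace Partitioning

noncomputable section

open MeasureTheory Set Filter Topology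

/-! ## Analysis -/

/-- A negative second derivative would make x a local maximum too. Then f would be constant near x,
with second derivative zero. -/
theorem deriv_deriv_nonneg_of_isLocalMin {f : ℝ → ℝ} {x : ℝ} (h : IsLocalMin f x)
    (hf : ContinuousAt f x) : 0 ≤ deriv (deriv f) x := by
  by_contra! hneg
  have hmax := isLocalMax_of_deriv_deriv_neg hneg h.deriv_eq_zero hf
  have heq : f =ᶠ[𝓝 x] fun _ => f x := by
    filter_upwards [h, hmax] with y h1 h2 using le_antisymm h2 h1
  have h2 : deriv f =ᶠ[𝓝 x] fun _ => 0 := by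
    refine heq.deriv.trans (Eventually.of_forall fun y => ?_)
    simp
  rw [h2.deriv_eq] at hneg
  simp at hneg

/-! ### Integrals over a compact set, depending on a parameter -/

section ParametricIntegral

variable {X : Type*} [TopologicalSpace X] {K : Set X} {T : Set ℝ}

/-- Compactness of a closed ball times K supplies the constant that dominates the integrands in the
two results below. -/
theorem exists_bound_near {f : ℝ × X → ℝ} (hK : IsCompact K) (hT : IsOpen T)
    (hf : ContinuousOn f (T ×ˢ K)) {t : ℝ} (ht : t ∈ T) :
    ∃ δ > 0, Metric.ball t δ ⊆ T ∧ ∃ C, ∀ r ∈ Metric.ball t δ, ∀ x ∈ K, ‖f (r, x)‖ ≤ C := by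
  obtain ⟨δ, hδ, hsub⟩ := Metric.nhds_basis_closedBall.mem_iff.1 (hT.mem_nhds ht)
  obtain ⟨C, hC⟩ := ((isCompact_closedBall t δ).prod hK).exists_bound_of_continuousOn
    (hf.mono (prod_mono hsub subset_rfl))
  exact ⟨δ, hδ, Metric.ball_subset_closedBall.trans hsub, C,
    fun r hr x hx => hC (r, x) ⟨Metric.ball_subset_closedBall hr, hx⟩⟩

variable [MeasurableSpace X] [OpensMeasurableSpace X] [T2Space X]
  {μ : Measure X} [IsFiniteMeasureOnCompacts μ]

theorem integrableOn_slice {f : ℝ × X → ℝ} (hK : IsCompact K)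
    (hf : ContinuousOn f (T ×ˢ K)) {t : ℝ} (ht : t ∈ T) :
    IntegrableOn (fun x => f (t, x)) K μ :=
  ContinuousOn.integrableOn_compact hK
    (hf.comp (by fun_prop) fun x hx => ⟨ht, hx⟩)

theorem continuousOn_setIntegral {f : ℝ × X → ℝ} (hK : IsCompact K) (hT : IsOpen T)
    (hf : ContinuousOn f (T ×ˢ K)) :
    ContinuousOn (fun t => ∫ x in K, f (t, x) ∂μ) T := by
  intro t ht
  apply ContinuousAt.continuousWithinAt
  obtain ⟨δ, hδ, hsub, C, hC⟩ := exists_bound_near hK hT hf ht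
  refine continuousAt_of_dominated (bound := fun _ => C) ?_ ?_ ?_ ?_
  · filter_upwards [Metric.ball_mem_nhds t hδ] with r hr
    exact (integrableOn_slice (μ := μ) hK hf (hsub hr)).aestronglyMeasurable
  · filter_upwards [Metric.ball_mem_nhds t hδ] with r hr
    exact ae_restrict_of_forall_mem hK.measurableSet fun x hx => hC r hr x hx
  · exact (continuousOn_const).integrableOn_compact hK
  · refine ae_restrict_of_forall_mem hK.measurableSet fun x hx => ?_
    have h1 : ContinuousOn (fun r => f (r, x)) T :=
      hf.comp (by fun_prop) fun r hr => ⟨hr, hx⟩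
    exact h1.continuousAt (hT.mem_nhds ht)

theorem hasDerivAt_setIntegral {f f' : ℝ × X → ℝ} (hK : IsCompact K) (hT : IsOpen T)
    (hf : ContinuousOn f (T ×ˢ K)) (hf' : ContinuousOn f' (T ×ˢ K))
    (hd : ∀ t ∈ T, ∀ x ∈ K, HasDerivAt (fun r => f (r, x)) (f' (t, x)) t) {t : ℝ} (ht : t ∈ T) :
    HasDerivAt (fun r => ∫ x in K, f (r, x) ∂μ) (∫ x in K, f' (t, x) ∂μ) t := by
  obtain ⟨δ, hδ, hsub, C, hC⟩ := exists_bound_near hK hT hf' ht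
  refine (hasDerivAt_integral_of_dominated_loc_of_deriv_le (F' := fun r x => f' (r, x))
    (bound := fun _ => C) (Metric.ball_mem_nhds t hδ) ?_ ?_ ?_ ?_ ?_ ?_).2
  · filter_upwards [Metric.ball_mem_nhds t hδ] with r hr
    exact (integrableOn_slice (μ := μ) hK hf (hsub hr)).aestronglyMeasurable
  · exact integrableOn_slice hK hf ht
  · exact (integrableOn_slice (μ := μ) hK hf' ht).aestronglyMeasurable
  · exact ae_restrict_of_forall_mem hK.measurableSet fun x hx r hr => hC r hr x hx
  · exact (continuousOn_const).integrableOn_compact hK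
  · exact ae_restrict_of_forall_mem hK.measurableSet fun x hx r hr => hd r (hsub hr) x hx

end ParametricIntegral

section ParametricIntegralSmooth

variable {X : Type*} [NormedAddCommGroup X] [NormedSpace ℝ X]

theorem hasDerivAt_slice {f : ℝ × X → ℝ} {t : ℝ} {x : X} (hf : DifferentiableAt ℝ f (t, x)) :
    HasDerivAt (fun r => f (r, x)) (fderiv ℝ f (t, x) (1, 0)) t := by
  have h1 : HasDerivAt (fun r : ℝ => (r, x)) (1, 0) t :=
    (hasDerivAt_id t).prodMk (hasDerivAt_const t x)
  exact hf.hasFDerivAt.comp_hasDerivAt t h1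

variable [MeasurableSpace X] [OpensMeasurableSpace X]
  {μ : Measure X} [IsFiniteMeasureOnCompacts μ] {K : Set X} {T : Set ℝ} {W : Set (ℝ × X)}

theorem hasDerivAt_setIntegral_of_contDiffOn {f : ℝ × X → ℝ} (hK : IsCompact K) (hT : IsOpen T)
    (hW : IsOpen W) (hsub : T ×ˢ K ⊆ W) (hf : ContDiffOn ℝ 1 f W) {t : ℝ} (ht : t ∈ T) :
    HasDerivAt (fun r => ∫ x in K, f (r, x) ∂μ) (∫ x in K, fderiv ℝ f (t, x) (1, 0) ∂μ) t := by
  refine hasDerivAt_setIntegral (f' := fun y => fderiv ℝ f y (1, 0)) hK hT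
    (hf.continuousOn.mono hsub) ?_ (fun t ht x hx => ?_) ht
  · exact ((hf.continuousOn_fderiv_of_isOpen hW le_rfl).mono hsub).clm_apply continuousOn_const
  · exact hasDerivAt_slice
      ((hf.contDiffAt (hW.mem_nhds (hsub ⟨ht, hx⟩))).differentiableAt one_ne_zero)

/-- Induction on n: the derivative of the integral is the integral of ∂f/∂t, which is one degree
less smooth on the same W. The open W around T × K lets full derivatives be used up to the boundary
of K. -/
theorem contDiffOn_setIntegral (n : ℕ) {f : ℝ × X → ℝ} (hK : IsCompact K) (hT : IsOpen T)
    (hW : IsOpen W) (hsub : T ×ˢ K ⊆ W) (hf : ContDiffOn ℝ n f W) :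
    ContDiffOn ℝ n (fun r => ∫ x in K, f (r, x) ∂μ) T := by
  induction n generalizing f with
  | zero =>
    exact contDiffOn_zero.2 (continuousOn_setIntegral hK hT (hf.continuousOn.mono hsub))
  | succ n ih =>
    have hd := fun t ht => hasDerivAt_setIntegral_of_contDiffOn (μ := μ) hK hT hW hsub
      (hf.of_le (by exact_mod_cast Nat.le_add_left 1 n)) (t := t) ht
    push_cast
    rw [contDiffOn_succ_iff_deriv_of_isOpen hT]
    refine ⟨fun t ht => (hd t ht).differentiableAt.differentiableWithinAt, by simp, ?_⟩
    refine (ih (f := fun y => fderiv ℝ f y (1, 0)) ?_).congr fun t ht => (hd t ht).deriv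
    exact (hf.fderiv_of_isOpen hW (by norm_cast)).clm_apply contDiffOn_const

end ParametricIntegralSmooth

theorem intervalIntegral_intervalIntegral_eq_setIntegral {a b c d : ℝ} (hab : a ≤ b) (hcd : c ≤ d)
    {f : ℝ × ℝ → ℝ} (hf : ContinuousOn f (Icc a b ×ˢ Icc c d)) :
    ∫ s in a..b, ∫ z in c..d, f (s, z) = ∫ x in Icc a b ×ˢ Icc c d, f x := by
  have hi : IntegrableOn f (Icc a b ×ˢ Icc c d) (volume.prod volume) :=
    hf.integrableOn_compact (isCompact_Icc.prod isCompact_Icc)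
  rw [Measure.volume_eq_prod, setIntegral_prod _ hi, intervalIntegral.integral_of_le hab,
    integral_Icc_eq_integral_Ioc]
  refine setIntegral_congr_fun measurableSet_Ioc fun s _ => ?_
  show _ = ∫ z in Icc c d, f (s, z)
  rw [intervalIntegral.integral_of_le hcd, integral_Icc_eq_integral_Ioc]

theorem contDiffOn_primitive (n : ℕ) {G : ℝ → ℝ} {δ : ℝ} (hδ : 0 < δ)
    (hG : ContDiffOn ℝ n G (Ioo (-δ) δ)) :
    ContDiffOn ℝ (n + 1) (fun t => ∫ r in (0 : ℝ)..t, G r) (Ioo (-δ) δ) := by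
  have h0 : (0 : ℝ) ∈ Ioo (-δ) δ := ⟨by linarith, hδ⟩
  have hd : ∀ t ∈ Ioo (-δ) δ, HasDerivAt (fun t => ∫ r in (0 : ℝ)..t, G r) (G t) t := by
    intro t ht
    have hsub : uIcc 0 t ⊆ Ioo (-δ) δ := (ordConnected_Ioo).uIcc_subset h0 ht
    exact intervalIntegral.integral_hasDerivAt_right
      (hG.continuousOn.mono hsub).intervalIntegrable
      (hG.continuousOn.stronglyMeasurableAtFilter isOpen_Ioo t ht)
      (hG.continuousOn.continuousAt (isOpen_Ioo.mem_nhds ht))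
  rw [contDiffOn_succ_iff_deriv_of_isOpen isOpen_Ioo]
  exact ⟨fun t ht => (hd t ht).differentiableAt.differentiableWithinAt, by simp,
    hG.congr fun t ht => (hd t ht).deriv⟩

/-! ### Pull-back of a divergence -/

section Divergence

variable {E : Type*} [NormedAddCommGroup E] [NormedSpace ℝ E]

theorem fderiv_tripleProduct {A B C : E → Fin 3 → ℝ} {x : E} (hA : DifferentiableAt ℝ A x)
    (hB : DifferentiableAt ℝ B x) (hC : DifferentiableAt ℝ C x) (u : E) :
    fderiv ℝ (fun y => A y ⬝ᵥ crossProduct (B y) (C y)) x u =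
      fderiv ℝ A x u ⬝ᵥ crossProduct (B x) (C x) + A x ⬝ᵥ crossProduct (fderiv ℝ B x u) (C x) +
        A x ⬝ᵥ crossProduct (B x) (fderiv ℝ C x u) := by
  have coord : ∀ {D : E → Fin 3 → ℝ}, DifferentiableAt ℝ D x → ∀ i : Fin 3, HasFDerivAt
      (fun y => D y i) ((ContinuousLinearMap.proj i : (Fin 3 → ℝ) →L[ℝ] ℝ).comp (fderiv ℝ D x)) x :=
    fun hD => hasFDerivAt_pi'.1 hD.hasFDerivAt
  have hA' := coord hA
  have hB' := coord hB
  have hC' := coord hC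
  have key := (((hA' 0).mul (((hB' 1).mul (hC' 2)).sub ((hB' 2).mul (hC' 1)))).add
      ((hA' 1).mul (((hB' 2).mul (hC' 0)).sub ((hB' 0).mul (hC' 2))))).add
      ((hA' 2).mul (((hB' 0).mul (hC' 1)).sub ((hB' 1).mul (hC' 0))))
  have heq : (fun y => A y ⬝ᵥ crossProduct (B y) (C y)) = fun y =>
      A y 0 * (B y 1 * C y 2 - B y 2 * C y 1) + A y 1 * (B y 2 * C y 0 - B y 0 * C y 2) +
        A y 2 * (B y 0 * C y 1 - B y 1 * C y 0) := by
    funext y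
    simp [cross_apply, dotProduct, Fin.sum_univ_three]
  rw [heq, HasFDerivAt.fderiv (by exact key)]
  simp [cross_apply, dotProduct, Fin.sum_univ_three]
  ring

/-- This is d(f*ω) = f*(dω) for the 2-form ω = ι_Y vol, evaluated on the constant vectors u, v, w.
The first-order terms add up to the trace of DY times the determinant. -/
theorem divergence_pullback {Y : (Fin 3 → ℝ) → Fin 3 → ℝ} {f : E → Fin 3 → ℝ} {x : E}
    (hf : ContDiffAt ℝ 2 f x) (hY : DifferentiableAt ℝ Y (f x)) (u v w : E) :
    fderiv ℝ (fun y => Y (f y) ⬝ᵥ crossProduct (fderiv ℝ f y v) (fderiv ℝ f y w)) x u +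
      fderiv ℝ (fun y => Y (f y) ⬝ᵥ crossProduct (fderiv ℝ f y w) (fderiv ℝ f y u)) x v +
      fderiv ℝ (fun y => Y (f y) ⬝ᵥ crossProduct (fderiv ℝ f y u) (fderiv ℝ f y v)) x w =
    (∑ i, fderiv ℝ Y (f x) (Pi.single i 1) i) *
      (fderiv ℝ f x u ⬝ᵥ crossProduct (fderiv ℝ f x v) (fderiv ℝ f x w)) := by
  have hfd : DifferentiableAt ℝ f x := hf.differentiableAt (by norm_num)
  have hf2 : DifferentiableAt ℝ (fderiv ℝ f) x :=
    (hf.fderiv_right (m := 1) (by norm_num)).differentiableAt (by norm_num)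
  have hB : ∀ v, DifferentiableAt ℝ (fun y => fderiv ℝ f y v) x := fun v =>
    hf2.clm_apply (differentiableAt_const v)
  have hB' : ∀ v u, fderiv ℝ (fun y => fderiv ℝ f y v) x u = fderiv ℝ (fderiv ℝ f) x u v := by
    intro v u
    rw [fderiv_clm_apply hf2 (differentiableAt_const v)]
    simp
  have hA : DifferentiableAt ℝ (fun y => Y (f y)) x := hY.comp x hfd
  have hA' : ∀ u, fderiv ℝ (fun y => Y (f y)) x u =
      ∑ i, fderiv ℝ f x u i • fderiv ℝ Y (f x) (Pi.single i 1) := by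
    intro u
    have : fderiv ℝ (fun y => Y (f y)) x = (fderiv ℝ Y (f x)).comp (fderiv ℝ f x) :=
      fderiv_comp x hY hfd
    rw [this, ContinuousLinearMap.comp_apply]
    conv_lhs => rw [pi_eq_sum_univ' (fderiv ℝ f x u)]
    simp [map_sum]
  have hsymm : IsSymmSndFDerivAt ℝ f x := hf.isSymmSndFDerivAt (by simp)
  rw [fderiv_tripleProduct hA (hB v) (hB w), fderiv_tripleProduct hA (hB w) (hB u),
    fderiv_tripleProduct hA (hB u) (hB v)]
  simp only [hA', hB']
  -- The six terms with second derivatives of f cancel in pairs: the cross product is antisymmetric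
  -- and D²f is symmetric.
  rw [hsymm.eq v u, hsymm.eq w u, hsymm.eq w v]
  simp only [cross_apply, dotProduct, Fin.sum_univ_three, Matrix.cons_val_zero,
    Matrix.cons_val_one, Matrix.cons_val, Pi.add_apply, Pi.smul_apply, smul_eq_mul]
  ring

end Divergence

/-! ## The geometry of `ℍ²(κ) × ℝ` -/

theorem conf_denom_pos {κ : ℝ} (hκ : κ < 0) {p : Fin 2 → ℝ} (hp : p ∈ disk κ) :
    0 < 4 + κ * (p 0 ^ 2 + p 1 ^ 2) := by
  have h1 : p 0 ^ 2 + p 1 ^ 2 < (2 / √(-κ)) ^ 2 := hp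
  rw [div_pow, Real.sq_sqrt (by linarith), lt_div_iff₀ (by linarith)] at h1
  linarith

theorem space_denom_pos {κ : ℝ} (hκ : κ < 0) {p : Fin 3 → ℝ} (hp : p ∈ space κ) :
    0 < 4 + κ * (p 0 ^ 2 + p 1 ^ 2) := by
  simpa using conf_denom_pos hκ hp

theorem conf_pos {κ x y : ℝ} (h : 0 < 4 + κ * (x ^ 2 + y ^ 2)) : 0 < conf κ x y :=
  div_pos (by norm_num) h

theorem conf_mul_denom {κ x y : ℝ} (h : 0 < 4 + κ * (x ^ 2 + y ^ 2)) :
    conf κ x y * (4 + κ * (x ^ 2 + y ^ 2)) = 4 :=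
  div_mul_cancel₀ _ h.ne'

theorem isOpen_space (κ : ℝ) : IsOpen (space κ) := by
  have : space κ = {p : Fin 3 → ℝ | p 0 ^ 2 + p 1 ^ 2 < (2 / √(-κ)) ^ 2} := by
    ext p
    simp [space, disk]
  rw [this]
  exact isOpen_lt (by fun_prop) (by fun_prop)

section Derivatives

variable {E : Type*} [NormedAddCommGroup E] [NormedSpace ℝ E]

theorem hasFDerivAt_conf {κ : ℝ} {x y : E → ℝ} {x' y' : E →L[ℝ] ℝ} {e : E}
    (hx : HasFDerivAt x x' e) (hy : HasFDerivAt y y' e)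
    (h : 0 < 4 + κ * (x e ^ 2 + y e ^ 2)) :
    HasFDerivAt (fun e => conf κ (x e) (y e))
      ((-κ / 2 * conf κ (x e) (y e) ^ 2) • (x e • x' + y e • y')) e := by
  have h1 : HasFDerivAt (fun e => 4 + κ * (x e ^ 2 + y e ^ 2)) _ e :=
    (((hx.pow 2).add (hy.pow 2)).const_mul κ).const_add 4
  have h2 := ((hasDerivAt_inv h.ne').comp_hasFDerivAt e h1).const_mul 4
  refine (h2.congr_fderiv ?_).congr_of_eventuallyEq (Eventually.of_forall fun e => ?_)
  · ext v
    simp [conf]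
    field_simp
    ring
  · simp [conf, div_eq_mul_inv]

theorem contDiffAt_conf {κ : ℝ} {n : WithTop ℕ∞} {x y : E → ℝ} {e : E}
    (hx : ContDiffAt ℝ n x e) (hy : ContDiffAt ℝ n y e)
    (h : 0 < 4 + κ * (x e ^ 2 + y e ^ 2)) :
    ContDiffAt ℝ n (fun e => conf κ (x e) (y e)) e :=
  contDiffAt_const.div (contDiffAt_const.add
    (contDiffAt_const.mul ((hx.pow 2).add (hy.pow 2)))) h.ne'

end Derivatives

section Pd

theorem hasFDerivAt_apply' {ι : Type} [Fintype ι] (i : ι) (p : ι → ℝ) :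
    HasFDerivAt (fun x : ι → ℝ => x i) (ContinuousLinearMap.proj (R := ℝ) i) p :=
  hasFDerivAt_apply i p

variable {ι : Type} [Fintype ι] [DecidableEq ι]

theorem pd_const {E : Type} [NormedAddCommGroup E] [NormedSpace ℝ E] (i : ι) (c : E)
    (p : ι → ℝ) : pd i (fun _ => c) p = 0 := by
  simp [pd]

theorem pd_congr {E : Type} [NormedAddCommGroup E] [NormedSpace ℝ E] {f h : (ι → ℝ) → E}
    {p : ι → ℝ} (i : ι) (hfh : f =ᶠ[𝓝 p] h) : pd i f p = pd i h p := by
  rw [pd, pd, hfh.fderiv_eq]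

theorem pd_neg (i : ι) (f : (ι → ℝ) → ℝ) (p : ι → ℝ) :
    pd i (fun x => -f x) p = -pd i f p := by
  simp [pd, fderiv_fun_neg]

theorem pd_conf_sq {κ : ℝ} (a b i : ι) {p : ι → ℝ} (h : 0 < 4 + κ * (p a ^ 2 + p b ^ 2)) :
    pd i (fun x => conf κ (x a) (x b) ^ 2) p =
      -κ * conf κ (p a) (p b) ^ 3 *
        (p a * (Pi.single i 1 : ι → ℝ) a + p b * (Pi.single i 1 : ι → ℝ) b) := by
  have h1 := (hasFDerivAt_conf (hasFDerivAt_apply' a p) (hasFDerivAt_apply' b p) h).pow 2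
  rw [pd, h1.fderiv]
  simp
  ring

theorem pd_conf_mul {κ : ℝ} (a b c i : ι) {p : ι → ℝ} (h : 0 < 4 + κ * (p a ^ 2 + p b ^ 2)) :
    pd i (fun x => -κ / 2 * conf κ (x a) (x b) * x c) p =
      κ ^ 2 / 4 * conf κ (p a) (p b) ^ 2 * p c *
        (p a * (Pi.single i 1 : ι → ℝ) a + p b * (Pi.single i 1 : ι → ℝ) b) -
      κ / 2 * conf κ (p a) (p b) * (Pi.single i 1 : ι → ℝ) c := by
  have h1 := ((hasFDerivAt_conf (hasFDerivAt_apply' a p) (hasFDerivAt_apply' b p) h).const_mul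
    (-κ / 2)).mul (hasFDerivAt_apply' c p)
  rw [pd, HasFDerivAt.fderiv (by exact h1)]
  simp
  ring

end Pd

theorem inv_metricH {κ : ℝ} {p : Fin 2 → ℝ} (h : 0 < 4 + κ * (p 0 ^ 2 + p 1 ^ 2)) :
    (metricH κ p)⁻¹ = Matrix.diagonal
      ![(conf κ (p 0) (p 1) ^ 2)⁻¹, (conf κ (p 0) (p 1) ^ 2)⁻¹] := by
  have := (conf_pos h).ne'
  apply Matrix.inv_eq_right_inv
  rw [metricH, Matrix.diagonal_mul_diagonal, ← Matrix.diagonal_one]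
  congr 1
  ext i
  fin_cases i <;> simp [this]

theorem inv_metricHR {κ : ℝ} {p : Fin 3 → ℝ} (h : 0 < 4 + κ * (p 0 ^ 2 + p 1 ^ 2)) :
    (metricHR κ p)⁻¹ = Matrix.diagonal
      ![(conf κ (p 0) (p 1) ^ 2)⁻¹, (conf κ (p 0) (p 1) ^ 2)⁻¹, 1] := by
  have := (conf_pos h).ne'
  apply Matrix.inv_eq_right_inv
  rw [metricHR, Matrix.diagonal_mul_diagonal, ← Matrix.diagonal_one]
  congr 1
  ext i
  fin_cases i <;> simp [this]

/-- The partial derivative in the direction of `c` of the logarithm of the conformal factor. -/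
def logConfDeriv {ι : Type} (κ : ℝ) (a b c : ι) (p : ι → ℝ) : ℝ :=
  -κ / 2 * conf κ (p a) (p b) * p c

/-- The Christoffel symbols of a conformally flat plane, where `a` and `b` are the partial
derivatives of the logarithm of the conformal factor, extended by zero to three indices. -/
def conformalChristoffel (a b : ℝ) : ℕ → ℕ → ℕ → ℝ
  | 0, 0, 0 => a
  | 0, 0, 1 => b
  | 0, 1, 0 => b
  | 0, 1, 1 => -a
  | 1, 0, 0 => -b
  | 1, 0, 1 => a
  | 1, 1, 0 => a
  | 1, 1, 1 => b
  | _, _, _ => 0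

theorem christoffel_metricH {κ : ℝ} {p : Fin 2 → ℝ} (h : 0 < 4 + κ * (p 0 ^ 2 + p 1 ^ 2))
    (k i j : Fin 2) : christoffel (metricH κ) k i j p =
      conformalChristoffel (logConfDeriv κ 0 1 0 p) (logConfDeriv κ 0 1 1 p) k i j := by
  have hσ := (conf_pos h).ne'
  rw [christoffel, inv_metricH h]
  fin_cases k <;> fin_cases i <;> fin_cases j <;>
    simp [Fin.sum_univ_two, metricH, pd_const, pd_conf_sq _ _ _ h, logConfDeriv,
      conformalChristoffel] <;>
    field_simp

theorem christoffel_metricHR {κ : ℝ} {p : Fin 3 → ℝ} (h : 0 < 4 + κ * (p 0 ^ 2 + p 1 ^ 2))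
    (k i j : Fin 3) : christoffel (metricHR κ) k i j p =
      conformalChristoffel (logConfDeriv κ 0 1 0 p) (logConfDeriv κ 0 1 1 p) k i j := by
  have hσ := (conf_pos h).ne'
  rw [christoffel, inv_metricHR h]
  fin_cases k <;> fin_cases i <;> fin_cases j <;>
    simp [Fin.sum_univ_three, metricHR, pd_const, pd_conf_sq _ _ _ h, logConfDeriv,
      conformalChristoffel] <;>
    field_simp

theorem pd_logConfDeriv {ι : Type} [Fintype ι] [DecidableEq ι] {κ : ℝ} (a b c i : ι) {p : ι → ℝ}
    (h : 0 < 4 + κ * (p a ^ 2 + p b ^ 2)) :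
    pd i (fun x => logConfDeriv κ a b c x) p =
      κ ^ 2 / 4 * conf κ (p a) (p b) ^ 2 * p c *
        (p a * (Pi.single i 1 : ι → ℝ) a + p b * (Pi.single i 1 : ι → ℝ) b) -
      κ / 2 * conf κ (p a) (p b) * (Pi.single i 1 : ι → ℝ) c :=
  pd_conf_mul a b c i h

theorem pd_christoffel_metricHR {κ : ℝ} (hκ : κ < 0) {p : Fin 3 → ℝ} (hp : p ∈ space κ)
    (l k i j : Fin 3) : pd l (christoffel (metricHR κ) k i j) p =
      pd l (fun p => conformalChristoffel (logConfDeriv κ 0 1 0 p) (logConfDeriv κ 0 1 1 p)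
        k i j) p := by
  apply pd_congr
  filter_upwards [(isOpen_space κ).mem_nhds hp] with x hx
  exact christoffel_metricHR (space_denom_pos hκ hx) k i j

/-- The horizontal part of the Ricci tensor of `ℍ²(κ) × ℝ`. -/
theorem ricciTensor_metricHR {κ : ℝ} (hκ : κ < 0) {p : Fin 3 → ℝ} (hp : p ∈ space κ)
    (i j : Fin 2) : ricciTensor (metricHR κ) i.castSucc j.castSucc p =
      if i = j then κ * conf κ (p 0) (p 1) ^ 2 else 0 := by
  have h := space_denom_pos hκ hp
  have hσ := conf_mul_denom h
  simp only [ricciTensor, pd_christoffel_metricHR hκ hp, christoffel_metricHR h]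
  fin_cases i <;> fin_cases j <;>
    simp [Fin.sum_univ_three, pd_const, pd_neg, pd_logConfDeriv _ _ _ _ h, conformalChristoffel]
  all_goals simp only [logConfDeriv]
  -- The diagonal entries are −Δ log σ, and `hσ` turns this expression into κσ².
  · linear_combination -κ * conf κ (p 0) (p 1) / 4 * hσ
  · ring
  · ring
  · linear_combination -κ * conf κ (p 0) (p 1) / 4 * hσ

theorem ric_metricHR {κ : ℝ} (hκ : κ < 0) {p : Fin 3 → ℝ} (hp : p ∈ space κ) {v : Fin 3 → ℝ}
    (hv : v 2 = 0) :
    ric (metricHR κ) p v = κ * (conf κ (p 0) (p 1) ^ 2 * (v 0 ^ 2 + v 1 ^ 2)) := by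
  have h := ricciTensor_metricHR hκ hp
  have h00 := h 0 0
  have h01 := h 0 1
  have h10 := h 1 0
  have h11 := h 1 1
  simp only [Fin.castSucc_zero, Fin.castSucc_one, if_true] at h00 h01 h10 h11
  simp only [ric, Fin.sum_univ_three, hv, h00, h01, h10, h11]
  simp
  ring

theorem ip_metricHR (κ : ℝ) (p v w : Fin 3 → ℝ) : ip (metricHR κ) p v w =
    conf κ (p 0) (p 1) ^ 2 * (v 0 * w 0 + v 1 * w 1) + v 2 * w 2 := by
  simp [ip, metricHR, Matrix.mulVec_diagonal, dotProduct, Fin.sum_univ_three]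
  ring

theorem ip_metricH (κ : ℝ) (p v w : Fin 2 → ℝ) : ip (metricH κ) p v w =
    conf κ (p 0) (p 1) ^ 2 * (v 0 * w 0 + v 1 * w 1) := by
  simp [ip, metricH, Matrix.mulVec_diagonal, dotProduct, Fin.sum_univ_two]
  ring

/-! ## Vertical cylinders -/

/-- The Riemannian speed of a curve in `ℍ²(κ)`. -/
def speed (κ : ℝ) (α : ℝ → Fin 2 → ℝ) (s : ℝ) : ℝ :=
  conf κ (α s 0) (α s 1) * √(deriv α s 0 ^ 2 + deriv α s 1 ^ 2)

section Cylinder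

variable {κ κg : ℝ} {I : Set ℝ} {α : ℝ → Fin 2 → ℝ} {L : ℝ}

theorem hasDerivAt_of_contDiffOn (hI : IsOpen I) (hα : ContDiffOn ℝ ∞ α I) {s : ℝ} (hs : s ∈ I) :
    HasDerivAt α (deriv α s) s :=
  ((hα.contDiffAt (hI.mem_nhds hs)).differentiableAt (by simp)).hasDerivAt

theorem contDiffOn_deriv (hI : IsOpen I) (hα : ContDiffOn ℝ ∞ α I) :
    ContDiffOn ℝ ∞ (deriv α) I :=
  hα.deriv_of_isOpen hI (by simp)

theorem normSq_deriv_pos {s : ℝ} (hreg : deriv α s ≠ 0) :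
    0 < deriv α s 0 ^ 2 + deriv α s 1 ^ 2 := by
  by_contra! h
  have h0 : deriv α s 0 ^ 2 = 0 := le_antisymm (by nlinarith [sq_nonneg (deriv α s 1)])
    (sq_nonneg _)
  have h1 : deriv α s 1 ^ 2 = 0 := le_antisymm (by nlinarith [sq_nonneg (deriv α s 0)])
    (sq_nonneg _)
  apply hreg
  ext i
  fin_cases i
  · exact pow_eq_zero_iff two_ne_zero |>.1 h0
  · exact pow_eq_zero_iff two_ne_zero |>.1 h1

theorem hasFDerivAt_comp_fst {f : ℝ → ℝ} {f' : ℝ} {q : Fin 2 → ℝ} (hf : HasDerivAt f f' (q 0)) :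
    HasFDerivAt (fun x : Fin 2 → ℝ => f (x 0))
      ((ContinuousLinearMap.proj (R := ℝ) (φ := fun _ : Fin 2 => ℝ) 0).smulRight f') q :=
  (hf.comp_hasFDerivAt q (hasFDerivAt_apply' 0 q)).congr_fderiv (by ext; simp [mul_comm])

theorem hasFDerivAt_cylinder {β : ℝ → Fin 2 → ℝ} {β' : Fin 2 → ℝ} {q : Fin 2 → ℝ}
    (hβ : HasDerivAt β β' (q 0)) :
    HasFDerivAt (cylinder β) (ContinuousLinearMap.pi
      ![(ContinuousLinearMap.proj (R := ℝ) 0).smulRight (β' 0),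
        (ContinuousLinearMap.proj (R := ℝ) 0).smulRight (β' 1),
        ContinuousLinearMap.proj (R := ℝ) 1]) q := by
  have hβ' := hasDerivAt_pi.1 hβ
  refine hasFDerivAt_pi'.2 fun k => ?_
  fin_cases k
  · exact hasFDerivAt_comp_fst (hβ' 0)
  · exact hasFDerivAt_comp_fst (hβ' 1)
  · exact (hasFDerivAt_apply' 1 q).congr_fderiv (by ext; simp)

theorem pd_zero_cylinder (hI : IsOpen I) (hα : ContDiffOn ℝ ∞ α I) {q : Fin 2 → ℝ}
    (hq : q 0 ∈ I) : pd 0 (cylinder α) q = ![deriv α (q 0) 0, deriv α (q 0) 1, 0] := by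
  rw [pd, (hasFDerivAt_cylinder (hasDerivAt_of_contDiffOn hI hα hq)).fderiv]
  ext k
  fin_cases k <;> simp

theorem pd_one_cylinder (hI : IsOpen I) (hα : ContDiffOn ℝ ∞ α I) {q : Fin 2 → ℝ}
    (hq : q 0 ∈ I) : pd 1 (cylinder α) q = ![0, 0, 1] := by
  rw [pd, (hasFDerivAt_cylinder (hasDerivAt_of_contDiffOn hI hα hq)).fderiv]
  ext k
  fin_cases k <;> simp

theorem eventually_mem (hI : IsOpen I) {q : Fin 2 → ℝ} (hq : q 0 ∈ I) :
    ∀ᶠ x : Fin 2 → ℝ in 𝓝 q, x 0 ∈ I :=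
  (continuous_apply 0).continuousAt.eventually_mem (hI.mem_nhds hq)

theorem pd_pd_one_cylinder (hI : IsOpen I) (hα : ContDiffOn ℝ ∞ α I) {q : Fin 2 → ℝ}
    (hq : q 0 ∈ I) (i : Fin 2) : pd i (pd 1 (cylinder α)) q = 0 := by
  rw [pd_congr i ((eventually_mem hI hq).mono fun x hx => pd_one_cylinder hI hα hx), pd_const]

theorem hasFDerivAt_pd_zero_cylinder (hI : IsOpen I) (hα : ContDiffOn ℝ ∞ α I) {q : Fin 2 → ℝ}
    (hq : q 0 ∈ I) :
    HasFDerivAt (pd 0 (cylinder α)) (ContinuousLinearMap.pi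
      ![(ContinuousLinearMap.proj (R := ℝ) 0).smulRight (deriv (deriv α) (q 0) 0),
        (ContinuousLinearMap.proj (R := ℝ) 0).smulRight (deriv (deriv α) (q 0) 1), 0]) q := by
  have hβ := hasDerivAt_pi.1 (hasDerivAt_of_contDiffOn hI (contDiffOn_deriv hI hα) hq)
  refine HasFDerivAt.congr_of_eventuallyEq (f := fun x : Fin 2 → ℝ =>
    ![deriv α (x 0) 0, deriv α (x 0) 1, 0]) ?_
    ((eventually_mem hI hq).mono fun x hx => pd_zero_cylinder hI hα hx)
  refine hasFDerivAt_pi'.2 fun k => ?_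
  fin_cases k
  · exact hasFDerivAt_comp_fst (hβ 0)
  · exact hasFDerivAt_comp_fst (hβ 1)
  · exact (hasFDerivAt_const (0 : ℝ) q).congr_fderiv (by ext; simp)

theorem pd_zero_pd_zero_cylinder (hI : IsOpen I) (hα : ContDiffOn ℝ ∞ α I) {q : Fin 2 → ℝ}
    (hq : q 0 ∈ I) : pd 0 (pd 0 (cylinder α)) q =
      ![deriv (deriv α) (q 0) 0, deriv (deriv α) (q 0) 1, 0] := by
  rw [pd, (hasFDerivAt_pd_zero_cylinder hI hα hq).fderiv]
  ext k
  fin_cases k <;> simp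

theorem pd_one_pd_zero_cylinder (hI : IsOpen I) (hα : ContDiffOn ℝ ∞ α I) {q : Fin 2 → ℝ}
    (hq : q 0 ∈ I) : pd 1 (pd 0 (cylinder α)) q = 0 := by
  rw [pd, (hasFDerivAt_pd_zero_cylinder hI hα hq).fderiv]
  ext k
  fin_cases k <;> simp

theorem speed_pos (hκ : κ < 0) {s : ℝ} (hmem : α s ∈ disk κ) (hreg : deriv α s ≠ 0) :
    0 < speed κ α s :=
  mul_pos (conf_pos (conf_denom_pos hκ hmem)) (Real.sqrt_pos.2 (normSq_deriv_pos hreg))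

theorem speed_sq (s : ℝ) : speed κ α s ^ 2 =
    conf κ (α s 0) (α s 1) ^ 2 * (deriv α s 0 ^ 2 + deriv α s 1 ^ 2) := by
  rw [speed, mul_pow, Real.sq_sqrt (by positivity)]

theorem firstFF_cylinder (hI : IsOpen I) (hα : ContDiffOn ℝ ∞ α I) {q : Fin 2 → ℝ}
    (hq : q 0 ∈ I) :
    firstFF (metricHR κ) (cylinder α) q = Matrix.diagonal ![speed κ α (q 0) ^ 2, 1] := by
  rw [speed_sq]
  ext i j
  fin_cases i <;> fin_cases j <;>
    simp [firstFF, ip_metricHR, pd_zero_cylinder hI hα hq, pd_one_cylinder hI hα hq,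
      cylinder, sq]

theorem inv_firstFF_cylinder (hκ : κ < 0) (hI : IsOpen I) (hα : ContDiffOn ℝ ∞ α I)
    {q : Fin 2 → ℝ} (hq : q 0 ∈ I) (hmem : α (q 0) ∈ disk κ) (hreg : deriv α (q 0) ≠ 0) :
    (firstFF (metricHR κ) (cylinder α) q)⁻¹ =
      Matrix.diagonal ![(speed κ α (q 0) ^ 2)⁻¹, 1] := by
  have := (speed_pos hκ hmem hreg).ne'
  rw [firstFF_cylinder hI hα hq]
  apply Matrix.inv_eq_right_inv
  rw [Matrix.diagonal_mul_diagonal, ← Matrix.diagonal_one]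
  congr 1
  ext i
  fin_cases i <;> simp [this]

theorem areaDensity_cylinder (hκ : κ < 0) (hI : IsOpen I) (hα : ContDiffOn ℝ ∞ α I)
    {q : Fin 2 → ℝ} (hq : q 0 ∈ I) (hmem : α (q 0) ∈ disk κ) (hreg : deriv α (q 0) ≠ 0) :
    areaDensity (metricHR κ) (cylinder α) q = speed κ α (q 0) := by
  rw [areaDensity, firstFF_cylinder hI hα hq, Matrix.det_diagonal]
  simp [Fin.prod_univ_two, Real.sqrt_sq (speed_pos hκ hmem hreg).le]

theorem unitNormal_cylinder (hκ : κ < 0) (hI : IsOpen I) (hα : ContDiffOn ℝ ∞ α I)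
    {q : Fin 2 → ℝ} (hq : q 0 ∈ I) (hmem : α (q 0) ∈ disk κ) (hreg : deriv α (q 0) ≠ 0) :
    unitNormal (metricHR κ) (cylinder α) q =
      (speed κ α (q 0))⁻¹ • ![deriv α (q 0) 1, -deriv α (q 0) 0, 0] := by
  have hd := conf_denom_pos hκ hmem
  have hσ := conf_pos hd
  have hv := normSq_deriv_pos hreg
  have hinv : (metricHR κ (cylinder α q))⁻¹ = _ := inv_metricHR (by simpa [cylinder] using hd)
  have hn : (metricHR κ (cylinder α q))⁻¹ *ᵥ crossProduct (pd 0 (cylinder α) q)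
      (pd 1 (cylinder α) q) = (conf κ (α (q 0) 0) (α (q 0) 1) ^ 2)⁻¹ •
        ![deriv α (q 0) 1, -deriv α (q 0) 0, 0] := by
    rw [hinv, pd_zero_cylinder hI hα hq, pd_one_cylinder hI hα hq]
    ext k
    fin_cases k <;> simp [Matrix.mulVec_diagonal, cross_apply, cylinder]
  have hip : √(ip (metricHR κ) (cylinder α q) ((conf κ (α (q 0) 0) (α (q 0) 1) ^ 2)⁻¹ •
        ![deriv α (q 0) 1, -deriv α (q 0) 0, 0]) ((conf κ (α (q 0) 0) (α (q 0) 1) ^ 2)⁻¹ •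
        ![deriv α (q 0) 1, -deriv α (q 0) 0, 0])) =
      (conf κ (α (q 0) 0) (α (q 0) 1))⁻¹ * √(deriv α (q 0) 0 ^ 2 + deriv α (q 0) 1 ^ 2) := by
    rw [Real.sqrt_eq_iff_mul_self_eq_of_pos (by positivity), ip_metricHR, mul_mul_mul_comm,
      Real.mul_self_sqrt hv.le]
    simp [cylinder]
    field_simp
    ring
  simp only [unitNormal]
  rw [hn, hip, smul_smul, speed]
  congr 1
  field_simp

theorem covDeriv_pd_zero_cylinder (hκ : κ < 0) (hI : IsOpen I) (hα : ContDiffOn ℝ ∞ α I)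
    {q : Fin 2 → ℝ} (hq : q 0 ∈ I) (hmem : α (q 0) ∈ disk κ) :
    covDeriv (metricHR κ) (cylinder α) (pd 0 (cylinder α)) 0 q =
      ![accel κ α (q 0) 0, accel κ α (q 0) 1, 0] := by
  have hd := conf_denom_pos hκ hmem
  have hΓ := christoffel_metricHR (p := cylinder α q) (by simpa [cylinder] using hd)
  have hΓ' := christoffel_metricH hd
  ext k
  simp only [covDeriv, hΓ, accel, hΓ', pd_zero_pd_zero_cylinder hI hα hq,
    pd_zero_cylinder hI hα hq]
  fin_cases k <;>
    simp [Fin.sum_univ_three, Fin.sum_univ_two, conformalChristoffel, logConfDeriv, cylinder]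

/-- The field ∂_z is parallel in the product, and the coordinate fields of the cylinder do not
depend on z. -/
theorem covDeriv_cylinder_eq_zero (hκ : κ < 0) (hI : IsOpen I) (hα : ContDiffOn ℝ ∞ α I)
    {q : Fin 2 → ℝ} (hq : q 0 ∈ I) (hmem : α (q 0) ∈ disk κ) {i j : Fin 2} (hij : i = 1 ∨ j = 1) :
    covDeriv (metricHR κ) (cylinder α) (pd j (cylinder α)) i q = 0 := by
  have hd := conf_denom_pos hκ hmem
  have hΓ := christoffel_metricHR (p := cylinder α q) (by simpa [cylinder] using hd)
  ext k
  simp only [covDeriv, hΓ]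
  fin_cases k <;> fin_cases i <;> fin_cases j <;> simp at hij <;>
    simp [Fin.sum_univ_three, conformalChristoffel, pd_zero_cylinder hI hα hq,
      pd_one_cylinder hI hα hq, pd_one_pd_zero_cylinder hI hα hq, pd_pd_one_cylinder hI hα hq]

/-- The minus sign arises because `unitNormal` lies to the right of α', whereas `geodesicCurvature`
is measured with the normal to the left. -/
theorem secondFF_cylinder_zero_zero (hκ : κ < 0) (hI : IsOpen I) (hα : ContDiffOn ℝ ∞ α I)
    {q : Fin 2 → ℝ} (hq : q 0 ∈ I) (hmem : α (q 0) ∈ disk κ) (hreg : deriv α (q 0) ≠ 0) :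
    secondFF (metricHR κ) (cylinder α) q 0 0 =
      -geodesicCurvature κ α (q 0) * speed κ α (q 0) ^ 2 := by
  have hs := (speed_pos hκ hmem hreg).ne'
  have hm : √(ip (metricH κ) (α (q 0)) (deriv α (q 0)) (deriv α (q 0))) = speed κ α (q 0) := by
    rw [ip_metricH, ← sq, ← sq, ← speed_sq, Real.sqrt_sq (speed_pos hκ hmem hreg).le]
  rw [secondFF, covDeriv_pd_zero_cylinder hκ hI hα hq hmem,
    unitNormal_cylinder hκ hI hα hq hmem hreg, geodesicCurvature, hm, ip_metricHR, ip_metricH]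
  simp [cylinder]
  field_simp
  ring

theorem secondFF_cylinder_eq_zero (hκ : κ < 0) (hI : IsOpen I) (hα : ContDiffOn ℝ ∞ α I)
    {q : Fin 2 → ℝ} (hq : q 0 ∈ I) (hmem : α (q 0) ∈ disk κ) {i j : Fin 2} (hij : i = 1 ∨ j = 1) :
    secondFF (metricHR κ) (cylinder α) q i j = 0 := by
  rw [secondFF, covDeriv_cylinder_eq_zero hκ hI hα hq hmem hij]
  simp [ip]

theorem meanCurvature_cylinder (hκ : κ < 0) (hI : IsOpen I) (hα : ContDiffOn ℝ ∞ α I)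
    {q : Fin 2 → ℝ} (hq : q 0 ∈ I) (hmem : α (q 0) ∈ disk κ) (hreg : deriv α (q 0) ≠ 0) :
    meanCurvature (metricHR κ) (cylinder α) q = -geodesicCurvature κ α (q 0) / 2 := by
  have hs := (speed_pos hκ hmem hreg).ne'
  simp [meanCurvature, inv_firstFF_cylinder hκ hI hα hq hmem hreg, Fin.sum_univ_two,
    secondFF_cylinder_zero_zero hκ hI hα hq hmem hreg,
    secondFF_cylinder_eq_zero hκ hI hα hq hmem]
  field_simp

theorem normSqSecondFF_cylinder (hκ : κ < 0) (hI : IsOpen I) (hα : ContDiffOn ℝ ∞ α I)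
    {q : Fin 2 → ℝ} (hq : q 0 ∈ I) (hmem : α (q 0) ∈ disk κ) (hreg : deriv α (q 0) ≠ 0) :
    normSqSecondFF (metricHR κ) (cylinder α) q = geodesicCurvature κ α (q 0) ^ 2 := by
  have hs := (speed_pos hκ hmem hreg).ne'
  simp [normSqSecondFF, inv_firstFF_cylinder hκ hI hα hq hmem hreg, Fin.sum_univ_two,
    secondFF_cylinder_zero_zero hκ hI hα hq hmem hreg,
    secondFF_cylinder_eq_zero hκ hI hα hq hmem]
  field_simp

/-- On a horizontal unit vector the Ricci curvature is the Gauss curvature of the base. With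
`normSqSecondFF_cylinder`, the zero-order coefficient of the Jacobi operator becomes κ_g² + κ. -/
theorem ric_unitNormal_cylinder (hκ : κ < 0) (hI : IsOpen I) (hα : ContDiffOn ℝ ∞ α I)
    {q : Fin 2 → ℝ} (hq : q 0 ∈ I) (hmem : α (q 0) ∈ disk κ) (hreg : deriv α (q 0) ≠ 0) :
    ric (metricHR κ) (cylinder α q) (unitNormal (metricHR κ) (cylinder α) q) = κ := by
  have hs := (speed_pos hκ hmem hreg).ne'
  have hsq := speed_sq (κ := κ) (α := α) (q 0)
  have hsp : cylinder α q ∈ space κ := by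
    have : ![α (q 0) 0, α (q 0) 1] = α (q 0) := by
      ext i
      fin_cases i <;> rfl
    simpa [space, cylinder, this] using hmem
  rw [unitNormal_cylinder hκ hI hα hq hmem hreg, ric_metricHR hκ hsp (by simp)]
  simp [cylinder]
  field_simp
  linear_combination -κ * hsq

/-! ### The horizontal planes -/

theorem pd_plane (c : ℝ) (i : Fin 2) (p : Fin 2 → ℝ) :
    pd i (plane c) p = ![(Pi.single i 1 : Fin 2 → ℝ) 0, (Pi.single i 1 : Fin 2 → ℝ) 1, 0] := by
  have h : HasFDerivAt (plane c) (ContinuousLinearMap.pi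
      ![ContinuousLinearMap.proj (R := ℝ) 0, ContinuousLinearMap.proj (R := ℝ) 1, 0]) p := by
    refine hasFDerivAt_pi'.2 fun k => ?_
    fin_cases k
    · exact (hasFDerivAt_apply' 0 p).congr_fderiv (by ext; simp)
    · exact (hasFDerivAt_apply' 1 p).congr_fderiv (by ext; simp)
    · exact (hasFDerivAt_const c p).congr_fderiv (by ext; simp)
  rw [pd, h.fderiv]
  ext k
  fin_cases k <;> simp

theorem unitNormal_plane (hκ : κ < 0) (c : ℝ) {p : Fin 2 → ℝ} (hp : p ∈ disk κ) :
    unitNormal (metricHR κ) (plane c) p = ![0, 0, 1] := by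
  have hinv : (metricHR κ (plane c p))⁻¹ = _ :=
    inv_metricHR (by simpa [plane] using conf_denom_pos hκ hp)
  have hn : (metricHR κ (plane c p))⁻¹ *ᵥ crossProduct (pd 0 (plane c) p) (pd 1 (plane c) p) =
      ![0, 0, 1] := by
    rw [hinv, pd_plane, pd_plane]
    ext k
    fin_cases k <;> simp [Matrix.mulVec_diagonal, cross_apply]
  simp only [unitNormal]
  rw [hn, ip_metricHR]
  simp

theorem secondFF_plane (hκ : κ < 0) (c : ℝ) {p : Fin 2 → ℝ} (hp : p ∈ disk κ) (i j : Fin 2) :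
    secondFF (metricHR κ) (plane c) p i j = 0 := by
  have hΓ := christoffel_metricHR (p := plane c p) (by simpa [plane] using conf_denom_pos hκ hp)
  have hpd : pd j (plane c) = fun _ => _ := funext fun p => pd_plane c j p
  rw [secondFF, unitNormal_plane hκ c hp, ip_metricHR]
  simp [covDeriv, hpd, pd_const, hΓ, conformalChristoffel, Fin.sum_univ_three]

theorem footPoint_cylinder (c s : ℝ) : footPoint (cylinder α) c s = α s := by
  ext i
  fin_cases i <;> simp [footPoint, cylinder]

theorem contactCos_cylinder (hκ : κ < 0) (hI : IsOpen I) (hα : ContDiffOn ℝ ∞ α I) {s : ℝ}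
    (hs : s ∈ I) (hmem : α s ∈ disk κ) (hreg : deriv α s ≠ 0) (e c : ℝ) :
    contactCos (metricHR κ) (cylinder α) e c s = 0 := by
  have hN : unitNormal (metricHR κ) (cylinder α) ![s, c] = _ :=
    unitNormal_cylinder (q := ![s, c]) hκ hI hα hs hmem hreg
  rw [contactCos, hN, supportNormal, footPoint_cylinder, unitNormal_plane hκ c hmem, ip_metricHR]
  simp

theorem isCapillary_cylinder (hκ : κ < 0) (hI : IsOpen I) (hα : ContDiffOn ℝ ∞ α I)
    (hmem : ∀ s ∈ I, α s ∈ disk κ) (hreg : ∀ s ∈ I, deriv α s ≠ 0)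
    (hcurv : ∀ s ∈ I, geodesicCurvature κ α s = κg) :
    IsCapillary (metricHR κ) (cylinder α) I L (-κg / 2) (Real.pi / 2) where
  cmc s hs z _ := by
    rw [meanCurvature_cylinder (q := ![s, z]) hκ hI hα hs (hmem s hs) (hreg s hs)]
    simp [hcurv s hs]
  angle_mem := ⟨by positivity, by linarith [Real.pi_pos]⟩
  angle_bottom s hs := by
    rw [contactCos_cylinder hκ hI hα hs (hmem s hs) (hreg s hs), Real.cos_pi_div_two]
  angle_top s hs := by
    rw [contactCos_cylinder hκ hI hα hs (hmem s hs) (hreg s hs), Real.cos_pi_div_two]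

/-- The first term vanishes because horizontal planes are totally geodesic, the second because cos γ
= 0. -/
theorem robinCoeff_cylinder (hκ : κ < 0) {s : ℝ} (hmem : α s ∈ disk κ) (e c : ℝ) :
    robinCoeff (metricHR κ) (cylinder α) (Real.pi / 2) e c s = 0 := by
  simp [robinCoeff, footPoint_cylinder, secondFF_plane hκ c hmem]

theorem conormalDeriv_cylinder (hκ : κ < 0) (hI : IsOpen I) (hα : ContDiffOn ℝ ∞ α I) {s : ℝ}
    (hs : s ∈ I) (hmem : α s ∈ disk κ) (hreg : deriv α s ≠ 0) (u : (Fin 2 → ℝ) → ℝ) (e c : ℝ) :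
    conormalDeriv (metricHR κ) (cylinder α) u e c s = e * pd 1 u ![s, c] := by
  have h : (firstFF (metricHR κ) (cylinder α) ![s, c])⁻¹ = _ :=
    inv_firstFF_cylinder (q := ![s, c]) hκ hI hα hs hmem hreg
  simp [conormalDeriv, conormal, h, Fin.sum_univ_two]

end Cylinder

/-! ## Integration over a rectangle -/

/-- The identification of `ℝ × ℝ` with the coordinate plane. -/
def pairMap : ℝ × ℝ →L[ℝ] (Fin 2 → ℝ) :=
  ContinuousLinearMap.pi ![ContinuousLinearMap.fst ℝ ℝ ℝ, ContinuousLinearMap.snd ℝ ℝ ℝ]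

theorem pairMap_apply (s z : ℝ) : pairMap (s, z) = ![s, z] := by
  ext i
  fin_cases i <;> simp [pairMap]

theorem isOpen_strip {I : Set ℝ} (hI : IsOpen I) : IsOpen {q : Fin 2 → ℝ | q 0 ∈ I} :=
  hI.preimage (continuous_apply 0)

theorem contDiffOn_pd {O : Set (Fin 2 → ℝ)} (hO : IsOpen O) {n m : WithTop ℕ∞}
    {f : (Fin 2 → ℝ) → ℝ} (hf : ContDiffOn ℝ n f O) (hmn : m + 1 ≤ n) (i : Fin 2) :
    ContDiffOn ℝ m (pd i f) O :=
  (hf.fderiv_of_isOpen hO hmn).clm_apply contDiffOn_const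

/-- Green's formula, needed both for the quadratic form and for the derivative of the flux of the
calibration. -/
theorem integral_rectangle_divergence {O : Set (Fin 2 → ℝ)} (hO : IsOpen O) {a b L : ℝ}
    (hab : a ≤ b) (hL : 0 ≤ L) (hsub : MapsTo pairMap (Icc a b ×ˢ Icc 0 L) O)
    {P Q : (Fin 2 → ℝ) → ℝ} (hP : ContDiffOn ℝ 1 P O) (hQ : ContDiffOn ℝ 1 Q O) :
    ∫ x in Icc a b ×ˢ Icc 0 L, (pd 0 P (pairMap x) + pd 1 Q (pairMap x)) =
      (((∫ s in a..b, Q ![s, L]) - ∫ s in a..b, Q ![s, 0]) + ∫ z in (0 : ℝ)..L, P ![b, z]) -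
        ∫ z in (0 : ℝ)..L, P ![a, z] := by
  have hcomp : ∀ {f : (Fin 2 → ℝ) → ℝ}, ContinuousOn f O →
      ContinuousOn (fun x => f (pairMap x)) (Icc a b ×ˢ Icc 0 L) := fun hf =>
    hf.comp pairMap.continuous.continuousOn hsub
  have hc : ContinuousOn (fun x => pd 0 P (pairMap x) + pd 1 Q (pairMap x))
      (Icc a b ×ˢ Icc 0 L) :=
    (hcomp (contDiffOn_pd hO hP (m := 0) (by simp) 0).continuousOn).add
      (hcomp (contDiffOn_pd hO hQ (m := 0) (by simp) 1).continuousOn)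
  have hd : ∀ {f : (Fin 2 → ℝ) → ℝ}, ContDiffOn ℝ 1 f O →
      ∀ x ∈ Ioo (min a b) (max a b) ×ˢ Ioo (min 0 L) (max 0 L),
      HasFDerivAt (fun x => f (pairMap x)) ((fderiv ℝ f (pairMap x)).comp pairMap) x := by
    intro f hf x hx
    rw [min_eq_left hab, max_eq_right hab, min_eq_left hL, max_eq_right hL] at hx
    have hx' : pairMap x ∈ O :=
      hsub ⟨Ioo_subset_Icc_self hx.1, Ioo_subset_Icc_self hx.2⟩
    have h1 := ((hf.contDiffAt (hO.mem_nhds hx')).differentiableAt one_ne_zero).hasFDerivAt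
    exact h1.comp x pairMap.hasFDerivAt
  have h := integral2_divergence_prod_of_hasFDerivAt (fun x => P (pairMap x))
    (fun x => Q (pairMap x)) _ _ a 0 b L
    (by rw [uIcc_of_le hab, uIcc_of_le hL]; exact hcomp hP.continuousOn)
    (by rw [uIcc_of_le hab, uIcc_of_le hL]; exact hcomp hQ.continuousOn)
    (hd hP) (hd hQ)
  have e0 : pairMap (1, 0) = Pi.single 0 1 := by
    ext i
    fin_cases i <;> simp [pairMap]
  have e1 : pairMap (0, 1) = Pi.single 1 1 := by
    ext i
    fin_cases i <;> simp [pairMap]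
  simp only [ContinuousLinearMap.comp_apply, e0, e1] at h
  rw [← intervalIntegral_intervalIntegral_eq_setIntegral hab hL hc]
  simp only [pairMap_apply] at h ⊢
  refine h ?_
  rw [uIcc_of_le hab, uIcc_of_le hL]
  exact hc.integrableOn_compact (isCompact_Icc.prod isCompact_Icc)

/-! ## The quadratic form of the second variation -/

section SecondVariation

variable {κ κg : ℝ} {I : Set ℝ} {α : ℝ → Fin 2 → ℝ} {L : ℝ} {u : (Fin 2 → ℝ) → ℝ}

theorem contDiffOn_speed (hκ : κ < 0) (hI : IsOpen I) (hα : ContDiffOn ℝ ∞ α I)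
    (hmem : ∀ s ∈ I, α s ∈ disk κ) (hreg : ∀ s ∈ I, deriv α s ≠ 0) :
    ContDiffOn ℝ ∞ (speed κ α) I := by
  have h0 := contDiffOn_pi.1 hα
  have h1 := contDiffOn_pi.1 (contDiffOn_deriv hI hα)
  intro s hs
  have hc : ContDiffAt ℝ ∞ (fun s => conf κ (α s 0) (α s 1)) s :=
    contDiffAt_conf ((h0 0).contDiffAt (hI.mem_nhds hs)) ((h0 1).contDiffAt (hI.mem_nhds hs))
      (conf_denom_pos hκ (hmem s hs))
  have hq : ContDiffAt ℝ ∞ (fun s => √(deriv α s 0 ^ 2 + deriv α s 1 ^ 2)) s :=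
    ((((h1 0).contDiffAt (hI.mem_nhds hs)).pow 2).add
      (((h1 1).contDiffAt (hI.mem_nhds hs)).pow 2)).sqrt (normSq_deriv_pos (hreg s hs)).ne'
  exact (hc.mul hq).contDiffWithinAt

theorem laplacian_cylinder (hκ : κ < 0) (hI : IsOpen I) (hα : ContDiffOn ℝ ∞ α I)
    (hmem : ∀ s ∈ I, α s ∈ disk κ) (hreg : ∀ s ∈ I, deriv α s ≠ 0) {q : Fin 2 → ℝ}
    (hq : q 0 ∈ I) : laplacian (metricHR κ) (cylinder α) u q = (speed κ α (q 0))⁻¹ *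
      (pd 0 (fun x => (speed κ α (x 0))⁻¹ * pd 0 u x) q +
        pd 1 (fun x => speed κ α (x 0) * pd 1 u x) q) := by
  have h0 : (fun x => areaDensity (metricHR κ) (cylinder α) x *
      ∑ j, (firstFF (metricHR κ) (cylinder α) x)⁻¹ 0 j * pd j u x) =ᶠ[𝓝 q]
      fun x => (speed κ α (x 0))⁻¹ * pd 0 u x := by
    filter_upwards [eventually_mem hI hq] with x hx
    have := (speed_pos hκ (hmem _ hx) (hreg _ hx)).ne'
    rw [areaDensity_cylinder hκ hI hα hx (hmem _ hx) (hreg _ hx),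
      inv_firstFF_cylinder hκ hI hα hx (hmem _ hx) (hreg _ hx)]
    simp [Fin.sum_univ_two]
    field_simp
  have h1 : (fun x => areaDensity (metricHR κ) (cylinder α) x *
      ∑ j, (firstFF (metricHR κ) (cylinder α) x)⁻¹ 1 j * pd j u x) =ᶠ[𝓝 q]
      fun x => speed κ α (x 0) * pd 1 u x := by
    filter_upwards [eventually_mem hI hq] with x hx
    rw [areaDensity_cylinder hκ hI hα hx (hmem _ hx) (hreg _ hx),
      inv_firstFF_cylinder hκ hI hα hx (hmem _ hx) (hreg _ hx)]
    simp [Fin.sum_univ_two]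
  rw [laplacian, areaDensity_cylinder hκ hI hα hq (hmem _ hq) (hreg _ hq), Fin.sum_univ_two,
    pd_congr 0 h0, pd_congr 1 h1]

theorem pd_mul {i : Fin 2} {f h : (Fin 2 → ℝ) → ℝ} {q : Fin 2 → ℝ}
    (hf : DifferentiableAt ℝ f q) (hh : DifferentiableAt ℝ h q) :
    pd i (fun x => f x * h x) q = f q * pd i h q + pd i f q * h q := by
  rw [pd, fderiv_fun_mul hf hh]
  simp [pd]
  ring

theorem edgeTerm_cylinder (hκ : κ < 0) (hI : IsOpen I) (hα : ContDiffOn ℝ ∞ α I)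
    (hmem : ∀ s ∈ I, α s ∈ disk κ) (hreg : ∀ s ∈ I, deriv α s ≠ 0) (e c : ℝ) :
    edgeTerm (metricHR κ) (cylinder α) I (Real.pi / 2) u e c =
      e * ∫ s in I, u ![s, c] * (speed κ α s * pd 1 u ![s, c]) := by
  rw [edgeTerm, ← integral_const_mul]
  refine setIntegral_congr_fun hI.measurableSet fun s hs => ?_
  have h : firstFF (metricHR κ) (cylinder α) ![s, c] = _ :=
    firstFF_cylinder (q := ![s, c]) hI hα hs
  simp only [conormalDeriv_cylinder hκ hI hα hs (hmem s hs) (hreg s hs),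
    robinCoeff_cylinder hκ (hmem s hs), h]
  simp [Real.sqrt_sq (speed_pos hκ (hmem s hs) (hreg s hs)).le]
  ring

/-- This is u Δu = div(u ∇u) − |∇u|² in coordinates with metric diag(v², 1), v the speed of α,
together with |A|² + Ric(N) = κ_g² + κ. The divergence is kept apart for Green's formula. -/
theorem jacobi_cylinder (hκ : κ < 0) (hI : IsOpen I) (hα : ContDiffOn ℝ ∞ α I)
    (hmem : ∀ s ∈ I, α s ∈ disk κ) (hreg : ∀ s ∈ I, deriv α s ≠ 0)
    (hcurv : ∀ s ∈ I, geodesicCurvature κ α s = κg) (hu : ContDiff ℝ ∞ u) {q : Fin 2 → ℝ}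
    (hq : q 0 ∈ I) :
    u q * jacobi (metricHR κ) (cylinder α) u q * areaDensity (metricHR κ) (cylinder α) q =
      (pd 0 (fun x => u x * ((speed κ α (x 0))⁻¹ * pd 0 u x)) q +
        pd 1 (fun x => u x * (speed κ α (x 0) * pd 1 u x)) q) -
      ((speed κ α (q 0))⁻¹ * pd 0 u q ^ 2 + speed κ α (q 0) * pd 1 u q ^ 2 +
        -(κg ^ 2 + κ) * (speed κ α (q 0) * u q ^ 2)) := by
  have hs := (speed_pos hκ (hmem _ hq) (hreg _ hq)).ne'
  have hud : DifferentiableAt ℝ u q := hu.differentiable (by simp) q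
  have hup : ∀ i, DifferentiableAt ℝ (pd i u) q := fun i =>
    ((hu.fderiv_right (m := ∞) (by simp)).clm_apply contDiff_const).differentiable (by simp) q
  have hsp : DifferentiableAt ℝ (fun x : Fin 2 → ℝ => speed κ α (x 0)) q :=
    (hasFDerivAt_comp_fst (((contDiffOn_speed hκ hI hα hmem hreg).contDiffAt
      (hI.mem_nhds hq)).differentiableAt (by simp)).hasDerivAt).differentiableAt
  rw [pd_mul (h := fun x => (speed κ α (x 0))⁻¹ * pd 0 u x) hud ((hsp.inv hs).mul (hup 0)),
    pd_mul (h := fun x => speed κ α (x 0) * pd 1 u x) hud (hsp.mul (hup 1)), jacobi,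
    laplacian_cylinder hκ hI hα hmem hreg hq,
    areaDensity_cylinder hκ hI hα hq (hmem _ hq) (hreg _ hq),
    normSqSecondFF_cylinder hκ hI hα hq (hmem _ hq) (hreg _ hq), hcurv _ hq,
    ric_unitNormal_cylinder hκ hI hα hq (hmem _ hq) (hreg _ hq)]
  field_simp
  ring

theorem setIntegral_eq_intervalIntegral_of_support {a b : ℝ} (hab : a ≤ b) (hsub : Icc a b ⊆ I)
    (hI : IsOpen I) {f : ℝ → ℝ} (hf : ∀ s, s ∉ Icc a b → f s = 0) :
    ∫ s in I, f s = ∫ s in a..b, f s := by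
  rw [intervalIntegral.integral_of_le hab, ← integral_Icc_eq_integral_Ioc]
  exact setIntegral_eq_of_subset_of_forall_sdiff_eq_zero hI.measurableSet hsub
    fun s hs => hf s hs.2

/-- Support conditions say nothing about the endpoints a and b themselves. As I is open, each
endpoint is a limit of points of I outside [a, b], and continuity decides. This removes the boundary
terms on the sides s = a and s = b. -/
theorem eq_zero_of_mem_closure_outside {a b : ℝ} {f : ℝ → ℝ} (hI : IsOpen I)
    (hf : ContinuousOn f I) (h : ∀ s ∈ I, s ∉ Icc a b → f s = 0) {s : ℝ} (hs : s ∈ I)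
    (hsab : s = a ∨ s = b) : f s = 0 := by
  have hc : ContinuousAt f s := hf.continuousAt (hI.mem_nhds hs)
  have hmemI := hI.mem_nhds hs
  rcases hsab with rfl | rfl
  · have h1 : Tendsto f (𝓝[<] s) (𝓝 (f s)) := hc.tendsto.mono_left nhdsWithin_le_nhds
    have h2 : f =ᶠ[𝓝[<] s] fun _ => 0 := by
      filter_upwards [self_mem_nhdsWithin, nhdsWithin_le_nhds hmemI] with x hx hxI
      exact h x hxI fun hx' => absurd hx'.1 (not_le.2 hx)
    exact tendsto_nhds_unique (h1.congr' h2) tendsto_const_nhds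
  · have h1 : Tendsto f (𝓝[>] s) (𝓝 (f s)) := hc.tendsto.mono_left nhdsWithin_le_nhds
    have h2 : f =ᶠ[𝓝[>] s] fun _ => 0 := by
      filter_upwards [self_mem_nhdsWithin, nhdsWithin_le_nhds hmemI] with x hx hxI
      exact h x hxI fun hx' => absurd hx'.2 (not_le.2 hx)
    exact tendsto_nhds_unique (h1.congr' h2) tendsto_const_nhds

/-- Green's formula produces no term on the sides, where u = 0, and on the two edges exactly the
integrals of u ∂u/∂ν that the form contains with the opposite sign. Only the integral of a
nonnegative density remains. -/
theorem secondVariation_cylinder_nonneg (hκ : κ < 0) (hκg : κg ^ 2 + κ ≤ 0) (hI : IsOpen I)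
    (hα : ContDiffOn ℝ ∞ α I) (hmem : ∀ s ∈ I, α s ∈ disk κ) (hreg : ∀ s ∈ I, deriv α s ≠ 0)
    (hcurv : ∀ s ∈ I, geodesicCurvature κ α s = κg) (hL : 0 < L) (hu : IsTestFunction I u) :
    0 ≤ secondVariation (metricHR κ) (cylinder α) I L (Real.pi / 2) u := by
  obtain ⟨hsm, a, b, hsub, hsupp⟩ := hu
  -- The definition of a test function allows an empty interval [a, b]; then u vanishes identically.
  rcases lt_or_ge b a with hba | hab
  · have h0 : ∀ q, u q = 0 := fun q => hsupp q (by simp [Icc_eq_empty_of_lt hba])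
    simp [secondVariation, edgeTerm, h0]
  have hsupp' : ∀ s z : ℝ, s ∉ Icc a b → u ![s, z] = 0 := fun s z hs => hsupp _ (by simpa using hs)
  have haI : a ∈ I := hsub ⟨le_rfl, hab⟩
  have hbI : b ∈ I := hsub ⟨hab, le_rfl⟩
  have hcont : ∀ z, Continuous fun s : ℝ => u ![s, z] := fun z =>
    hsm.continuous.comp (by fun_prop)
  have hua : ∀ z, u ![a, z] = 0 := fun z => eq_zero_of_mem_closure_outside hI
    (hcont z).continuousOn (fun s _ hs => hsupp' s z hs) haI (Or.inl rfl)
  have hub : ∀ z, u ![b, z] = 0 := fun z => eq_zero_of_mem_closure_outside hI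
    (hcont z).continuousOn (fun s _ hs => hsupp' s z hs) hbI (Or.inr rfl)
  have hspeed : ContDiffOn ℝ 1 (fun x : Fin 2 → ℝ => speed κ α (x 0)) {q | q 0 ∈ I} :=
    ((contDiffOn_speed hκ hI hα hmem hreg).of_le (by exact_mod_cast le_top)).comp
      (contDiff_apply ℝ ℝ 0).contDiffOn fun x hx => hx
  have hspeed0 : ∀ x ∈ {q : Fin 2 → ℝ | q 0 ∈ I}, speed κ α (x 0) ≠ 0 := fun x hx =>
    (speed_pos hκ (hmem _ hx) (hreg _ hx)).ne'
  have hu1 : ContDiffOn ℝ 1 u {q | q 0 ∈ I} :=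
    (hsm.of_le (by exact_mod_cast le_top)).contDiffOn
  have hup : ∀ i, ContDiffOn ℝ 1 (pd i u) {q | q 0 ∈ I} := fun i =>
    (((hsm.fderiv_right (m := ∞) (by simp)).clm_apply contDiff_const).of_le
      (by exact_mod_cast le_top)).contDiffOn
  have hP : ContDiffOn ℝ 1 (fun x => u x * ((speed κ α (x 0))⁻¹ * pd 0 u x)) {q | q 0 ∈ I} :=
    hu1.mul ((hspeed.inv hspeed0).mul (hup 0))
  have hQ : ContDiffOn ℝ 1 (fun x => u x * (speed κ α (x 0) * pd 1 u x)) {q | q 0 ∈ I} :=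
    hu1.mul (hspeed.mul (hup 1))
  set P := fun x => u x * ((speed κ α (x 0))⁻¹ * pd 0 u x) with hPdef
  set Q := fun x => u x * (speed κ α (x 0) * pd 1 u x) with hQdef
  -- The density of |∇u|² − (κ_g² + κ) u² with respect to ds dz.
  set G := fun q => (speed κ α (q 0))⁻¹ * pd 0 u q ^ 2 + speed κ α (q 0) * pd 1 u q ^ 2 +
    -(κg ^ 2 + κ) * (speed κ α (q 0) * u q ^ 2) with hGdef
  have hG : ContinuousOn G {q | q 0 ∈ I} :=
    (((hspeed.inv hspeed0).mul ((hup 0).pow 2)).add (hspeed.mul ((hup 1).pow 2))).add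
      (contDiffOn_const.mul (hspeed.mul (hu1.pow 2))) |>.continuousOn
  have hG0 : ∀ q ∈ {q : Fin 2 → ℝ | q 0 ∈ I}, 0 ≤ G q := by
    intro q hq
    have := speed_pos hκ (hmem _ hq) (hreg _ hq)
    have h1 : 0 ≤ -(κg ^ 2 + κ) := by linarith
    positivity
  have hdiv : ContinuousOn (fun q => pd 0 P q + pd 1 Q q) {q | q 0 ∈ I} :=
    (contDiffOn_pd (isOpen_strip hI) hP (m := 0) (by simp) 0).continuousOn.add (contDiffOn_pd (isOpen_strip hI) hQ (m := 0) (by simp) 1).continuousOn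
  have hK : IsCompact (Icc a b ×ˢ Icc 0 L) := isCompact_Icc.prod isCompact_Icc
  have hmaps : MapsTo pairMap (Icc a b ×ˢ Icc 0 L) {q : Fin 2 → ℝ | q 0 ∈ I} :=
    fun x hx => hsub hx.1
  have hcomp : ∀ {f : (Fin 2 → ℝ) → ℝ}, ContinuousOn f {q | q 0 ∈ I} →
      ContinuousOn (fun x => f (pairMap x)) (Icc a b ×ˢ Icc 0 L) := fun hf =>
    hf.comp pairMap.continuous.continuousOn hmaps
  have hmain : ∫ s in I, ∫ z in (0 : ℝ)..L, u ![s, z] * jacobi (metricHR κ) (cylinder α) u ![s, z] *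
      areaDensity (metricHR κ) (cylinder α) ![s, z] =
      (∫ x in Icc a b ×ˢ Icc 0 L, (pd 0 P (pairMap x) + pd 1 Q (pairMap x))) -
        ∫ x in Icc a b ×ˢ Icc 0 L, G (pairMap x) := by
    rw [setIntegral_eq_intervalIntegral_of_support hab hsub hI
      (fun s hs => by simp [hsupp' s _ hs])]
    rw [← integral_sub
      ((hcomp hdiv).integrableOn_compact hK)
      ((hcomp hG).integrableOn_compact hK),
      ← intervalIntegral_intervalIntegral_eq_setIntegral hab hL.le (f := fun x =>
        pd 0 P (pairMap x) + pd 1 Q (pairMap x) - G (pairMap x))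
        ((hcomp hdiv).sub (hcomp hG))]
    refine intervalIntegral.integral_congr fun s hs => ?_
    rw [uIcc_of_le hab] at hs
    refine intervalIntegral.integral_congr fun z _ => ?_
    simp only [pairMap_apply]
    exact jacobi_cylinder (q := ![s, z]) hκ hI hα hmem hreg hcurv hsm (hsub hs)
  have hGint : 0 ≤ ∫ x in Icc a b ×ˢ Icc 0 L, G (pairMap x) :=
    setIntegral_nonneg hK.measurableSet fun x hx => hG0 _ (hsub hx.1)
  have hPa : ∀ z, P ![a, z] = 0 := fun z => by simp [hPdef, hua]
  have hPb : ∀ z, P ![b, z] = 0 := fun z => by simp [hPdef, hub]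
  have hedge : ∀ c, ∫ s in I, u ![s, c] * (speed κ α s * pd 1 u ![s, c]) =
      ∫ s in a..b, Q ![s, c] := fun c =>
    setIntegral_eq_intervalIntegral_of_support hab hsub hI fun s hs => by simp [hsupp' s _ hs]
  rw [secondVariation, hmain, edgeTerm_cylinder hκ hI hα hmem hreg,
    edgeTerm_cylinder hκ hI hα hmem hreg, hedge, hedge,
    integral_rectangle_divergence (isOpen_strip hI) hab hL.le hmaps hP hQ]
  simp only [hPa, hPb, intervalIntegral.integral_zero]
  linarith

end SecondVariation

/-! ## Calibrations

The lines meeting all geodesics through a fixed ideal point `ξ` under a fixed angle have constant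
geodesic curvature and foliate the hyperbolic plane.  Their normal fields are unit fields of
constant divergence. -/

/-- The normal field `σ⁻¹ c (ξ - w)² / |ξ - w|²` of the foliation by lines through the ideal point
`ξ`, multiplied by the density `σ²`, on `ℍ²(κ) × ℝ`. -/
def idealField (κ : ℝ) (ξ c : Fin 2 → ℝ) (P : Fin 3 → ℝ) : Fin 3 → ℝ :=
  ![conf κ (P 0) (P 1) * ((c 0 * ((ξ 0 - P 0) ^ 2 - (ξ 1 - P 1) ^ 2) -
      c 1 * (2 * ((ξ 0 - P 0) * (ξ 1 - P 1)))) * ((ξ 0 - P 0) ^ 2 + (ξ 1 - P 1) ^ 2)⁻¹),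
    conf κ (P 0) (P 1) * ((c 0 * (2 * ((ξ 0 - P 0) * (ξ 1 - P 1))) +
      c 1 * ((ξ 0 - P 0) ^ 2 - (ξ 1 - P 1) ^ 2)) * ((ξ 0 - P 0) ^ 2 + (ξ 1 - P 1) ^ 2)⁻¹), 0]

/-- The condition `hξ` places ξ on the boundary circle, which the open disk does not meet. -/
theorem idealDist_pos {κ x y : ℝ} {ξ : Fin 2 → ℝ} (hξ : κ * (ξ 0 ^ 2 + ξ 1 ^ 2) = -4)
    (h : 0 < 4 + κ * (x ^ 2 + y ^ 2)) : 0 < (ξ 0 - x) ^ 2 + (ξ 1 - y) ^ 2 := by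
  by_contra! hn
  have h0 : (ξ 0 - x) ^ 2 = 0 := le_antisymm (by nlinarith [sq_nonneg (ξ 1 - y)]) (sq_nonneg _)
  have h1 : (ξ 1 - y) ^ 2 = 0 := le_antisymm (by nlinarith [sq_nonneg (ξ 0 - x)]) (sq_nonneg _)
  have hx : ξ 0 = x := sub_eq_zero.1 (pow_eq_zero_iff two_ne_zero |>.1 h0)
  have hy : ξ 1 = y := sub_eq_zero.1 (pow_eq_zero_iff two_ne_zero |>.1 h1)
  rw [hx, hy] at hξ
  linarith

theorem idealField_normSq {κ : ℝ} {ξ c : Fin 2 → ℝ} {P : Fin 3 → ℝ}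
    (hξ : κ * (ξ 0 ^ 2 + ξ 1 ^ 2) = -4) (hc : c 0 ^ 2 + c 1 ^ 2 = 1)
    (h : 0 < 4 + κ * (P 0 ^ 2 + P 1 ^ 2)) :
    idealField κ ξ c P 0 ^ 2 + idealField κ ξ c P 1 ^ 2 = conf κ (P 0) (P 1) ^ 2 := by
  have hN := (idealDist_pos hξ h).ne'
  simp only [idealField, Matrix.cons_val_zero, Matrix.cons_val_one]
  field_simp
  linear_combination conf κ (P 0) (P 1) ^ 2 * ((ξ 0 - P 0) ^ 2 + (ξ 1 - P 1) ^ 2) ^ 2 * hc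

theorem contDiffAt_idealField {κ : ℝ} {ξ c : Fin 2 → ℝ} {P : Fin 3 → ℝ}
    (hξ : κ * (ξ 0 ^ 2 + ξ 1 ^ 2) = -4) (h : 0 < 4 + κ * (P 0 ^ 2 + P 1 ^ 2)) :
    ContDiffAt ℝ ∞ (idealField κ ξ c) P := by
  have hN := (idealDist_pos hξ h).ne'
  have h0 : ContDiffAt ℝ ∞ (fun P : Fin 3 → ℝ => P 0) P := (contDiff_apply ℝ ℝ 0).contDiffAt
  have h1 : ContDiffAt ℝ ∞ (fun P : Fin 3 → ℝ => P 1) P := (contDiff_apply ℝ ℝ 1).contDiffAt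
  have hd0 : ContDiffAt ℝ ∞ (fun P : Fin 3 → ℝ => ξ 0 - P 0) P := contDiffAt_const.sub h0
  have hd1 : ContDiffAt ℝ ∞ (fun P : Fin 3 → ℝ => ξ 1 - P 1) P := contDiffAt_const.sub h1
  have hσ := contDiffAt_conf h0 h1 h
  have hNi := ((hd0.pow 2).add (hd1.pow 2)).inv hN
  have hs := (hd0.pow 2).sub (hd1.pow 2)
  have hm := contDiffAt_const (c := (2 : ℝ)).mul (hd0.mul hd1)
  refine contDiffAt_pi.2 fun k => ?_
  fin_cases k
  · exact hσ.mul (((contDiffAt_const.mul hs).sub (contDiffAt_const.mul hm)).mul hNi)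
  · exact hσ.mul (((contDiffAt_const.mul hm).add (contDiffAt_const.mul hs)).mul hNi)
  · exact contDiffAt_const

/-- With the density σ² built into the field, its Euclidean divergence is σ² times the Riemannian
one. The latter is therefore the constant (κ/2) Re(cξ), in complex notation. Since arg(cξ) is the
angle with the geodesics towards ξ, its values fill the range from −√(−κ) to √(−κ), the admissible
range of κ_g. -/
theorem divergence_idealField {κ : ℝ} {ξ c : Fin 2 → ℝ} {P : Fin 3 → ℝ}
    (hξ : κ * (ξ 0 ^ 2 + ξ 1 ^ 2) = -4) (h : 0 < 4 + κ * (P 0 ^ 2 + P 1 ^ 2)) :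
    ∑ i, fderiv ℝ (idealField κ ξ c) P (Pi.single i 1) i =
      κ / 2 * (c 0 * ξ 0 - c 1 * ξ 1) * conf κ (P 0) (P 1) ^ 2 := by
  have hN := (idealDist_pos hξ h).ne'
  have hX := ((contDiffAt_idealField (c := c) hξ h).differentiableAt (by simp)).hasFDerivAt
  have hX' := fun i => hasFDerivAt_pi'.1 hX i
  have h0 := (hasFDerivAt_apply' 0 P).const_sub (ξ 0)
  have h1 := (hasFDerivAt_apply' 1 P).const_sub (ξ 1)
  have hσ := hasFDerivAt_conf (hasFDerivAt_apply' 0 P) (hasFDerivAt_apply' 1 P) h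
  have hNi := (hasDerivAt_inv hN).comp_hasFDerivAt P ((h0.pow 2).add (h1.pow 2))
  have hs := (h0.pow 2).sub (h1.pow 2)
  have hm := (h0.mul h1).const_mul 2
  have e0 := (hX' 0).unique (by
    exact hσ.mul (((hs.const_mul (c 0)).sub (hm.const_mul (c 1))).mul hNi))
  have e1 := (hX' 1).unique (by
    exact hσ.mul (((hm.const_mul (c 0)).add (hs.const_mul (c 1))).mul hNi))
  have e2 := (hX' 2).unique (by exact hasFDerivAt_const (0 : ℝ) P)
  have e0' := congrArg (fun f : (Fin 3 → ℝ) →L[ℝ] ℝ => f (Pi.single 0 1)) e0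
  have e1' := congrArg (fun f : (Fin 3 → ℝ) →L[ℝ] ℝ => f (Pi.single 1 1)) e1
  have e2' := congrArg (fun f : (Fin 3 → ℝ) →L[ℝ] ℝ => f (Pi.single 2 1)) e2
  simp at e0' e1' e2'
  rw [Fin.sum_univ_three, e0', e1', e2']
  have hD := conf_mul_denom h
  generalize conf κ (P 0) (P 1) = σ at hD ⊢
  generalize P 0 = x at hD hN ⊢
  generalize P 1 = y at hD hN ⊢
  generalize ξ 0 = p at hξ hN ⊢
  generalize ξ 1 = q at hξ hN ⊢
  field_simp
  linear_combination σ * ((p - x) ^ 2 + (q - y) ^ 2) * (c 0 * (p - x) - c 1 * (q - y)) * hD -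
    σ ^ 2 * ((p - x) ^ 2 + (q - y) ^ 2) * (c 0 * (p - x) - c 1 * (q - y)) * hξ

/-! ### Curves of constant geodesic curvature -/

/-- The integrating factor exp(−∫h) turns y into a function with zero derivative. -/
theorem eq_zero_of_linear_ode {I : Set ℝ} (hI : IsOpen I) (hI' : I.OrdConnected) {h y : ℝ → ℝ}
    (hh : ContinuousOn h I) (hy : ∀ s ∈ I, HasDerivAt y (h s * y s) s) {s₀ : ℝ} (hs₀ : s₀ ∈ I)
    (h0 : y s₀ = 0) : ∀ s ∈ I, y s = 0 := by
  have hH : ∀ s ∈ I, HasDerivAt (fun t => ∫ r in s₀..t, h r) (h s) s := fun s hs =>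
    intervalIntegral.integral_hasDerivAt_right
      (hh.mono (hI'.uIcc_subset hs₀ hs)).intervalIntegrable
      (hh.stronglyMeasurableAtFilter hI s hs) (hh.continuousAt (hI.mem_nhds hs))
  have hd : ∀ s ∈ I, HasDerivAt (fun t => y t * Real.exp (-∫ r in s₀..t, h r)) 0 s := fun s hs =>
    ((hy s hs).mul (hH s hs).neg.exp).congr_deriv (by ring)
  intro s hs
  have := hI.is_const_of_deriv_eq_zero hI'.isPreconnected
    (fun t ht => (hd t ht).differentiableAt.differentiableWithinAt)
    (fun t ht => (hd t ht).deriv) hs hs₀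
  simpa [h0] using this

theorem eq_of_hasDerivAt_zero {I : Set ℝ} (hI : IsOpen I) (hI' : I.OrdConnected) {y : ℝ → ℝ}
    (hy : ∀ s ∈ I, HasDerivAt y 0 s) {s t : ℝ} (hs : s ∈ I) (ht : t ∈ I) : y s = y t :=
  hI.is_const_of_deriv_eq_zero hI'.isPreconnected
    (fun t ht => (hy t ht).differentiableAt.differentiableWithinAt)
    (fun t ht => (hy t ht).deriv) hs ht

/-- A line of curvature `κg` with normal `n` at the point `(x, y)` ends in an ideal point `ξ`. -/
theorem exists_idealPoint {κ κg x y n₀ n₁ : ℝ} (hκ : κ < 0) (hκg : κg ^ 2 + κ ≤ 0)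
    (h : 0 < 4 + κ * (x ^ 2 + y ^ 2)) (hn : n₀ ^ 2 + n₁ ^ 2 = 1) :
    ∃ ξ : Fin 2 → ℝ, κ * (ξ 0 ^ 2 + ξ 1 ^ 2) = -4 ∧
      ξ 0 * (n₀ * ((ξ 0 - x) ^ 2 - (ξ 1 - y) ^ 2) + n₁ * (2 * ((ξ 0 - x) * (ξ 1 - y)))) -
        ξ 1 * (n₁ * ((ξ 0 - x) ^ 2 - (ξ 1 - y) ^ 2) - n₀ * (2 * ((ξ 0 - x) * (ξ 1 - y)))) =
      2 * κg / κ * ((ξ 0 - x) ^ 2 + (ξ 1 - y) ^ 2) := by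
  have hκ0 := hκ.ne
  -- Write w = x + iy, n = n₀ + i n₁, d = ξ − w. The requirement on ξ is Re χ = 2κ_g/κ for χ = ξ n
  -- d̄/d, a number of modulus |ξ|. So χ is chosen first, on the circle |χ|² = −4/κ; the curvature
  -- bound says that this circle reaches the prescribed real part.
  obtain ⟨χ₁, hχ⟩ : ∃ χ₁ : ℝ, κ * ((2 * κg / κ) ^ 2 + χ₁ ^ 2) = -4 := by
    refine ⟨√(-4 * (κ + κg ^ 2) / κ ^ 2), ?_⟩
    rw [Real.sq_sqrt (div_nonneg (by nlinarith) (by positivity))]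
    field_simp
    ring
  generalize 2 * κg / κ = χ₀ at hχ ⊢
  -- With η = χ n̄ the equation is ξ d̄ = η d. It becomes linear after replacing |ξ|² by R = −4/κ,
  -- and its solution is ξ = (R + ηw)/(η + w̄).
  obtain ⟨η₀, hη₀⟩ : ∃ η₀, η₀ = χ₀ * n₀ + χ₁ * n₁ := ⟨_, rfl⟩
  obtain ⟨η₁, hη₁⟩ : ∃ η₁, η₁ = χ₁ * n₀ - χ₀ * n₁ := ⟨_, rfl⟩
  have hη : κ * (η₀ ^ 2 + η₁ ^ 2) = -4 := by
    rw [hη₀, hη₁]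
    linear_combination hχ + κ * (χ₀ ^ 2 + χ₁ ^ 2) * hn
  -- The denominator η + w̄ does not vanish: η lies on the boundary circle and −w̄ inside it.
  have hδ : 0 < (η₀ + x) ^ 2 + (η₁ - y) ^ 2 := by
    have := idealDist_pos (ξ := ![η₀, η₁]) (x := -x) (y := y) (κ := κ) (by simpa using hη)
      (by simpa using h)
    simpa using this
  obtain ⟨δ, hδd⟩ : ∃ δ, δ = (η₀ + x) ^ 2 + (η₁ - y) ^ 2 := ⟨_, rfl⟩
  rw [← hδd] at hδ
  obtain ⟨ξ₀, hξ₀⟩ : ∃ ξ₀, ξ₀ = ((-4 / κ + η₀ * x - η₁ * y) * (η₀ + x) +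
    (η₀ * y + η₁ * x) * (η₁ - y)) / δ := ⟨_, rfl⟩
  obtain ⟨ξ₁, hξ₁⟩ : ∃ ξ₁, ξ₁ = ((η₀ * y + η₁ * x) * (η₀ + x) -
    (-4 / κ + η₀ * x - η₁ * y) * (η₁ - y)) / δ := ⟨_, rfl⟩
  have hR : ∃ R, R = -4 / κ := ⟨_, rfl⟩
  obtain ⟨R, hR⟩ := hR
  have hκR : κ * R = -4 := by
    rw [hR]
    field_simp
  rw [← hR] at hξ₀ hξ₁
  have hηR : η₀ ^ 2 + η₁ ^ 2 = R := mul_left_cancel₀ hκ.ne (hη.trans hκR.symm)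
  have h1 : ξ₀ * (η₀ + x) - ξ₁ * (η₁ - y) = R + η₀ * x - η₁ * y := by
    rw [hξ₀, hξ₁]
    field_simp
    rw [hδd]
    ring
  have h2 : ξ₀ * (η₁ - y) + ξ₁ * (η₀ + x) = η₀ * y + η₁ * x := by
    rw [hξ₀, hξ₁]
    field_simp
    rw [hδd]
    ring
  -- The solution of the linear equation does lie on the circle, because |η|² = R gives |R + ηw| =
  -- |η| |η̄ + w|.
  have hξR : ξ₀ ^ 2 + ξ₁ ^ 2 = R := by
    apply mul_left_cancel₀ hδ.ne'
    have : δ * (ξ₀ ^ 2 + ξ₁ ^ 2) = (R + η₀ * x - η₁ * y) ^ 2 + (η₀ * y + η₁ * x) ^ 2 := by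
      rw [← h1, ← h2, hδd]
      ring
    rw [this, hδd]
    linear_combination (x ^ 2 + y ^ 2 - R) * hηR
  refine ⟨![ξ₀, ξ₁], by simp [hξR, hκR], ?_⟩
  simp only [Matrix.cons_val_zero, Matrix.cons_val_one]
  -- `hA` and `hB` are the real and imaginary parts of ξ d̄ = η d.
  have hA : ξ₀ * (ξ₀ - x) + ξ₁ * (ξ₁ - y) = η₀ * (ξ₀ - x) - η₁ * (ξ₁ - y) := by
    linear_combination hξR - h1
  have hB : ξ₁ * (ξ₀ - x) - ξ₀ * (ξ₁ - y) = η₀ * (ξ₁ - y) + η₁ * (ξ₀ - x) := by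
    linear_combination -h2
  have e0 : n₀ * η₀ - n₁ * η₁ = χ₀ := by
    rw [hη₀, hη₁]
    linear_combination χ₀ * hn
  linear_combination (n₀ * (ξ₀ - x) + n₁ * (ξ₁ - y)) * hA -
    (n₁ * (ξ₀ - x) - n₀ * (ξ₁ - y)) * hB + ((ξ₀ - x) ^ 2 + (ξ₁ - y) ^ 2) * e0

/-- The evolution of `n (ξ - w)⁻² |ξ - w|²` along a curve `w` with normal `n`. -/
theorem hasDerivAt_normal_transport {n₀ n₁ d₀ d₁ : ℝ → ℝ} {ρ e s : ℝ}
    (hn₀ : HasDerivAt n₀ (-ρ * n₁ s) s) (hn₁ : HasDerivAt n₁ (ρ * n₀ s) s)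
    (hd₀ : HasDerivAt d₀ (e * n₁ s) s) (hd₁ : HasDerivAt d₁ (-e * n₀ s) s)
    (hN : d₀ s ^ 2 + d₁ s ^ 2 ≠ 0) :
    HasDerivAt (fun t => (n₀ t * (d₀ t ^ 2 - d₁ t ^ 2) + n₁ t * (2 * (d₀ t * d₁ t))) *
      (d₀ t ^ 2 + d₁ t ^ 2)⁻¹)
      (-(ρ + 2 * e * (n₀ s * d₀ s + n₁ s * d₁ s) * (d₀ s ^ 2 + d₁ s ^ 2)⁻¹) *
        ((n₁ s * (d₀ s ^ 2 - d₁ s ^ 2) - n₀ s * (2 * (d₀ s * d₁ s))) *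
          (d₀ s ^ 2 + d₁ s ^ 2)⁻¹)) s ∧
    HasDerivAt (fun t => (n₁ t * (d₀ t ^ 2 - d₁ t ^ 2) - n₀ t * (2 * (d₀ t * d₁ t))) *
      (d₀ t ^ 2 + d₁ t ^ 2)⁻¹)
      ((ρ + 2 * e * (n₀ s * d₀ s + n₁ s * d₁ s) * (d₀ s ^ 2 + d₁ s ^ 2)⁻¹) *
        ((n₀ s * (d₀ s ^ 2 - d₁ s ^ 2) + n₁ s * (2 * (d₀ s * d₁ s))) *
          (d₀ s ^ 2 + d₁ s ^ 2)⁻¹)) s := by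
  -- In complex notation n' = iρn and d' = −ien, so n d̄/d has the logarithmic derivative i(ρ + 2e
  -- Re(n/d)): it only rotates.
  have hdiff := (hd₀.pow 2).sub (hd₁.pow 2)
  have hprod := (hd₀.mul hd₁).const_mul 2
  have hinv := ((hd₀.pow 2).add (hd₁.pow 2)).inv hN
  constructor
  · refine (((hn₀.mul hdiff).add (hn₁.mul hprod)).mul hinv).congr_deriv ?_
    simp
    field_simp
    ring
  · refine (((hn₁.mul hdiff).sub (hn₀.mul hprod)).mul hinv).congr_deriv ?_
    simp
    field_simp
    ring

section Curve

variable {κ κg : ℝ} {I : Set ℝ} {α : ℝ → Fin 2 → ℝ}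

/-- The Euclidean speed of a plane curve. -/
def euclideanSpeed (α : ℝ → Fin 2 → ℝ) (s : ℝ) : ℝ := √(deriv α s 0 ^ 2 + deriv α s 1 ^ 2)

theorem euclideanSpeed_pos {s : ℝ} (hreg : deriv α s ≠ 0) : 0 < euclideanSpeed α s :=
  Real.sqrt_pos.2 (normSq_deriv_pos hreg)

theorem euclideanSpeed_sq (s : ℝ) :
    euclideanSpeed α s ^ 2 = deriv α s 0 ^ 2 + deriv α s 1 ^ 2 :=
  Real.sq_sqrt (by positivity)

theorem hasDerivAt_euclideanSpeed (hI : IsOpen I) (hα : ContDiffOn ℝ ∞ α I) {s : ℝ} (hs : s ∈ I)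
    (hreg : deriv α s ≠ 0) : HasDerivAt (euclideanSpeed α)
      ((deriv α s 0 * deriv (deriv α) s 0 + deriv α s 1 * deriv (deriv α) s 1) /
        euclideanSpeed α s) s := by
  have hd := hasDerivAt_pi.1 (hasDerivAt_of_contDiffOn hI (contDiffOn_deriv hI hα) hs)
  refine ((((hd 0).pow 2).add ((hd 1).pow 2)).sqrt (normSq_deriv_pos hreg).ne').congr_deriv ?_
  simp [euclideanSpeed]
  field_simp

/-- The rotation speed of the Euclidean normal of a curve in `ℍ²(κ)`, in terms of the geodesic
curvature. -/
theorem euclideanCurvature_eq (hκ : κ < 0) {s : ℝ} (hmem : α s ∈ disk κ) (hreg : deriv α s ≠ 0) :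
    (deriv α s 0 * deriv (deriv α) s 1 - deriv α s 1 * deriv (deriv α) s 0) /
        euclideanSpeed α s ^ 2 =
      conf κ (α s 0) (α s 1) * (geodesicCurvature κ α s * euclideanSpeed α s +
        κ / 2 * (α s 0 * deriv α s 1 - α s 1 * deriv α s 0)) := by
  have hd := conf_denom_pos hκ hmem
  have hσ := (conf_pos hd).ne'
  have he := (euclideanSpeed_pos hreg).ne'
  have hsq := euclideanSpeed_sq (α := α) s
  have hm : √(ip (metricH κ) (α s) (deriv α s) (deriv α s)) =
      conf κ (α s 0) (α s 1) * euclideanSpeed α s := by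
    rw [ip_metricH, ← sq, ← sq, ← speed_sq, Real.sqrt_sq (speed_pos hκ hmem hreg).le]
    rfl
  rw [geodesicCurvature, hm, ip_metricH]
  simp only [accel, christoffel_metricH hd, Fin.sum_univ_two]
  simp [conformalChristoffel, logConfDeriv]
  field_simp
  rw [hsq]
  ring

/-- Let ξ be an ideal endpoint for the data of α at one parameter s₀, and let c(s) be the unit
number for which the field `idealField κ ξ c` is normal to α at α(s). Constant geodesic curvature
makes c rotate at a speed proportional to y = Re(cξ) − 2κ_g/κ. Hence y solves a linear equation with
y(s₀) = 0, so y vanishes and c is constant. Thus α is a leaf of a single foliation, and no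
classification of the curves is needed. -/
theorem exists_calibration (hκ : κ < 0) (hκg : κg ^ 2 + κ ≤ 0) (hI : IsOpen I)
    (hI' : I.OrdConnected) (hα : ContDiffOn ℝ ∞ α I) (hmem : ∀ s ∈ I, α s ∈ disk κ)
    (hreg : ∀ s ∈ I, deriv α s ≠ 0) (hcurv : ∀ s ∈ I, geodesicCurvature κ α s = κg)
    (hne : I.Nonempty) :
    ∃ X : (Fin 3 → ℝ) → Fin 3 → ℝ, (∀ P ∈ space κ, ContDiffAt ℝ ∞ X P) ∧
      (∀ P ∈ space κ, X P 0 ^ 2 + X P 1 ^ 2 = conf κ (P 0) (P 1) ^ 2) ∧ (∀ P, X P 2 = 0) ∧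
      (∀ P ∈ space κ, ∑ i, fderiv ℝ X P (Pi.single i 1) i = κg * conf κ (P 0) (P 1) ^ 2) ∧
      ∀ q : Fin 2 → ℝ, q 0 ∈ I → X (cylinder α q) 0 * deriv α (q 0) 1 -
        X (cylinder α q) 1 * deriv α (q 0) 0 = speed κ α (q 0) := by
  obtain ⟨s₀, hs₀⟩ := hne
  have he0 : ∀ s ∈ I, euclideanSpeed α s ≠ 0 := fun s hs => (euclideanSpeed_pos (hreg s hs)).ne'
  have hden : ∀ s ∈ I, 0 < 4 + κ * (α s 0 ^ 2 + α s 1 ^ 2) := fun s hs =>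
    conf_denom_pos hκ (hmem s hs)
  -- The Euclidean unit normal to the right of α', the side of `unitNormal` for the cylinder.
  set n₀ := fun s => deriv α s 1 / euclideanSpeed α s with hn₀
  set n₁ := fun s => -deriv α s 0 / euclideanSpeed α s with hn₁
  have hn : ∀ s ∈ I, n₀ s ^ 2 + n₁ s ^ 2 = 1 := by
    intro s hs
    have h1 := he0 s hs
    simp only [hn₀, hn₁]
    field_simp
    linear_combination -euclideanSpeed_sq (α := α) s
  obtain ⟨ξ, hξ, hξ0⟩ := exists_idealPoint hκ hκg (hden s₀ hs₀) (hn s₀ hs₀)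
  have hN : ∀ s ∈ I, (ξ 0 - α s 0) ^ 2 + (ξ 1 - α s 1) ^ 2 ≠ 0 := fun s hs =>
    (idealDist_pos hξ (hden s hs)).ne'
  set d₀ := fun s => ξ 0 - α s 0 with hd₀
  set d₁ := fun s => ξ 1 - α s 1 with hd₁
  set c₀ := fun t => (n₀ t * (d₀ t ^ 2 - d₁ t ^ 2) + n₁ t * (2 * (d₀ t * d₁ t))) *
      (d₀ t ^ 2 + d₁ t ^ 2)⁻¹ with hc₀
  set c₁ := fun t => (n₁ t * (d₀ t ^ 2 - d₁ t ^ 2) - n₀ t * (2 * (d₀ t * d₁ t))) *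
      (d₀ t ^ 2 + d₁ t ^ 2)⁻¹ with hc₁
  set y := fun t => c₀ t * ξ 0 - c₁ t * ξ 1 - 2 * κg / κ with hy
  have hκ0 := hκ.ne
  have hderiv : ∀ s ∈ I,
      HasDerivAt c₀ (κ / 2 * speed κ α s * y s * c₁ s) s ∧
      HasDerivAt c₁ (-(κ / 2 * speed κ α s * y s) * c₀ s) s := by
    intro s hs
    have he := he0 s hs
    have hα' := hasDerivAt_pi.1 (hasDerivAt_of_contDiffOn hI hα hs)
    have hα'' := hasDerivAt_pi.1 (hasDerivAt_of_contDiffOn hI (contDiffOn_deriv hI hα) hs)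
    have hE := hasDerivAt_euclideanSpeed hI hα hs (hreg s hs)
    have hsq := euclideanSpeed_sq (α := α) s
    obtain ⟨ρ, hρ⟩ : ∃ ρ, ρ = (deriv α s 0 * deriv (deriv α) s 1 -
      deriv α s 1 * deriv (deriv α) s 0) / euclideanSpeed α s ^ 2 := ⟨_, rfl⟩
    have hρ' := euclideanCurvature_eq hκ (hmem s hs) (hreg s hs)
    rw [← hρ, hcurv s hs] at hρ'
    have h1 : HasDerivAt n₀ (-ρ * n₁ s) s := by
      refine ((hα'' 1).div hE he).congr_deriv ?_
      simp only [hn₁, hρ]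
      field_simp
      rw [hsq]
      ring
    have h2 : HasDerivAt n₁ (ρ * n₀ s) s := by
      refine ((hα'' 0).neg.div hE he).congr_deriv ?_
      simp only [hn₀, hρ, Pi.neg_apply]
      field_simp
      rw [hsq]
      ring
    have h3 : HasDerivAt d₀ (euclideanSpeed α s * n₁ s) s := by
      refine ((hα' 0).const_sub (ξ 0)).congr_deriv ?_
      simp only [hn₁]
      field_simp
    have h4 : HasDerivAt d₁ (-euclideanSpeed α s * n₀ s) s := by
      refine ((hα' 1).const_sub (ξ 1)).congr_deriv ?_
      simp only [hn₀]
      field_simp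
    obtain ⟨k0, k1⟩ := hasDerivAt_normal_transport h1 h2 h3 h4 (hN s hs)
    -- The rotation speed of c. The formula for ρ in terms of κ_g and the two relations `hD`, `hξ`
    -- reduce it to a multiple of y.
    have hθ : ρ + 2 * euclideanSpeed α s * (n₀ s * d₀ s + n₁ s * d₁ s) *
        (d₀ s ^ 2 + d₁ s ^ 2)⁻¹ = -(κ / 2 * speed κ α s * y s) := by
      have hw0 : deriv α s 1 = euclideanSpeed α s * n₀ s := by
        simp only [hn₀]
        field_simp
      have hw1 : deriv α s 0 = -euclideanSpeed α s * n₁ s := by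
        simp only [hn₁]
        field_simp
      have hD := conf_mul_denom (hden s hs)
      have hNs := hN s hs
      rw [hρ', hw0, hw1]
      simp only [hy, hc₀, hc₁, speed]
      change _ = -(κ / 2 * (conf κ (α s 0) (α s 1) * euclideanSpeed α s) * _)
      generalize euclideanSpeed α s = e at he ⊢
      generalize conf κ (α s 0) (α s 1) = σ at hD ⊢
      generalize n₀ s = m₀
      generalize n₁ s = m₁
      simp only [hd₀, hd₁]
      generalize α s 0 = x at hNs hD ⊢
      generalize α s 1 = z at hNs hD ⊢
      generalize ξ 0 = p at hξ hNs ⊢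
      generalize ξ 1 = q at hξ hNs ⊢
      field_simp
      linear_combination σ * (m₀ * (p - x) + m₁ * (q - z)) * hξ -
        (m₀ * (p - x) + m₁ * (q - z)) * hD
    rw [hθ] at k0 k1
    exact ⟨k0.congr_deriv (by simp only [hc₁]; ring), k1.congr_deriv (by simp only [hc₀])⟩
  -- The equation is y' = (κ/2) v Im(cξ) y with v the speed of α; the initial value is zero by the
  -- choice of ξ.
  have hy0 : ∀ s ∈ I, y s = 0 := by
    refine eq_zero_of_linear_ode hI hI'
      (h := fun s => κ / 2 * speed κ α s * (c₁ s * ξ 0 + c₀ s * ξ 1)) ?_ ?_ hs₀ ?_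
    · intro s hs
      have h1 := (hderiv s hs).1.continuousAt
      have h2 := (hderiv s hs).2.continuousAt
      have h3 := (contDiffOn_speed hκ hI hα hmem hreg).continuousOn.continuousAt (hI.mem_nhds hs)
      exact ((continuousAt_const.mul h3).mul ((h2.mul continuousAt_const).add
        (h1.mul continuousAt_const))).continuousWithinAt
    · intro s hs
      refine ((((hderiv s hs).1.mul_const (ξ 0)).sub ((hderiv s hs).2.mul_const (ξ 1))).sub_const
        _).congr_deriv ?_
      ring
    · have hNs := hN s₀ hs₀
      simp only [hy, hc₀, hc₁, hd₀, hd₁]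
      field_simp
      field_simp at hξ0
      linear_combination hξ0
  have hconst0 : ∀ s ∈ I, c₀ s = c₀ s₀ := fun s hs =>
    eq_of_hasDerivAt_zero hI hI'
      (fun t ht => (hderiv t ht).1.congr_deriv (by rw [hy0 t ht]; ring)) hs hs₀
  have hconst1 : ∀ s ∈ I, c₁ s = c₁ s₀ := fun s hs =>
    eq_of_hasDerivAt_zero hI hI'
      (fun t ht => (hderiv t ht).2.congr_deriv (by rw [hy0 t ht]; ring)) hs hs₀
  have hunit : c₀ s₀ ^ 2 + c₁ s₀ ^ 2 = 1 := by
    have h1 := hN s₀ hs₀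
    have h2 := hn s₀ hs₀
    simp only [hc₀, hc₁]
    change d₀ s₀ ^ 2 + d₁ s₀ ^ 2 ≠ 0 at h1
    field_simp
    linear_combination (d₀ s₀ ^ 2 + d₁ s₀ ^ 2) ^ 2 * h2
  refine ⟨idealField κ ξ ![c₀ s₀, c₁ s₀], fun P hP => contDiffAt_idealField hξ
    (space_denom_pos hκ hP), fun P hP => idealField_normSq hξ (by simpa using hunit)
    (space_denom_pos hκ hP), fun P => rfl, fun P hP => ?_, fun q hq => ?_⟩
  · rw [divergence_idealField hξ (space_denom_pos hκ hP)]
    have h1 : c₀ s₀ * ξ 0 - c₁ s₀ * ξ 1 = 2 * κg / κ := sub_eq_zero.1 (hy0 s₀ hs₀)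
    simp only [Matrix.cons_val_zero, Matrix.cons_val_one]
    rw [h1]
    field_simp
  · have h1 := hN _ hq
    have he := he0 _ hq
    have hsq := euclideanSpeed_sq (α := α) (q 0)
    simp only [idealField, cylinder, Matrix.cons_val_zero, Matrix.cons_val_one,
      ← hconst0 _ hq, ← hconst1 _ hq, speed]
    change _ = conf κ (α (q 0) 0) (α (q 0) 1) * euclideanSpeed α (q 0)
    simp only [hc₀, hc₁, hn₀, hn₁, hd₀, hd₁]
    generalize conf κ (α (q 0) 0) (α (q 0) 1) = σ
    field_simp
    rw [hsq]
    ring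

end Curve

/-! ## Admissible variations -/

section Parametric

variable {W : Set (ℝ × (Fin 2 → ℝ))} {T : Set ℝ} {a b L : ℝ}

/-- The map `(t, (s, z)) ↦ (t, ![s, z])`. -/
def timePairMap : ℝ × ℝ × ℝ →L[ℝ] ℝ × (Fin 2 → ℝ) :=
  (ContinuousLinearMap.id ℝ ℝ).prodMap pairMap

theorem timePairMap_apply (t : ℝ) (x : ℝ × ℝ) : timePairMap (t, x) = (t, pairMap x) := rfl

theorem contDiffOn_rectangleIntegral (n : ℕ) {f : ℝ × (Fin 2 → ℝ) → ℝ} (hT : IsOpen T)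
    (hW : IsOpen W) (hsub : ∀ t ∈ T, ∀ x ∈ Icc a b ×ˢ Icc 0 L, (t, pairMap x) ∈ W)
    (hf : ContDiffOn ℝ n f W) :
    ContDiffOn ℝ n (fun t => ∫ x in Icc a b ×ˢ Icc 0 L, f (t, pairMap x)) T :=
  contDiffOn_setIntegral (f := fun y => f (timePairMap y)) (W := timePairMap ⁻¹' W) n
    (isCompact_Icc.prod isCompact_Icc) hT (hW.preimage timePairMap.continuous)
    (fun y hy => hsub y.1 hy.1 y.2 hy.2)
    (hf.comp timePairMap.contDiff.contDiffOn fun _ hy => hy)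

theorem hasDerivAt_rectangleIntegral {f : ℝ × (Fin 2 → ℝ) → ℝ} (hT : IsOpen T)
    (hW : IsOpen W) (hsub : ∀ t ∈ T, ∀ x ∈ Icc a b ×ˢ Icc 0 L, (t, pairMap x) ∈ W)
    (hf : ContDiffOn ℝ 1 f W) {t : ℝ} (ht : t ∈ T) :
    HasDerivAt (fun t => ∫ x in Icc a b ×ˢ Icc 0 L, f (t, pairMap x))
      (∫ x in Icc a b ×ˢ Icc 0 L, fderiv ℝ f (t, pairMap x) (1, 0)) t := by
  have h := hasDerivAt_setIntegral_of_contDiffOn (μ := volume) (f := fun y => f (timePairMap y))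
    (W := timePairMap ⁻¹' W)
    (isCompact_Icc.prod isCompact_Icc) hT (hW.preimage timePairMap.continuous)
    (fun y hy => hsub y.1 hy.1 y.2 hy.2)
    (hf.comp timePairMap.contDiff.contDiffOn fun _ hy => hy) ht
  refine h.congr_deriv (setIntegral_congr_fun
    (isCompact_Icc.prod isCompact_Icc).measurableSet fun x hx => ?_)
  have h1 := ((hf.contDiffAt (hW.mem_nhds (hsub t ht x hx))).differentiableAt
    one_ne_zero).hasFDerivAt
  have h2 : HasFDerivAt (fun y => f (timePairMap y))
      ((fderiv ℝ f (t, pairMap x)).comp timePairMap) (t, x) :=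
    HasFDerivAt.comp (t, x) (by exact h1) timePairMap.hasFDerivAt
  simp only [h2.fderiv, ContinuousLinearMap.comp_apply, timePairMap_apply, map_zero]

theorem continuousOn_rectangle_slice {f : ℝ × (Fin 2 → ℝ) → ℝ} {t : ℝ}
    (hsub : ∀ x ∈ Icc a b ×ˢ Icc 0 L, (t, pairMap x) ∈ W) (hf : ContinuousOn f W) :
    ContinuousOn (fun x => f (t, pairMap x)) (Icc a b ×ˢ Icc 0 L) :=
  hf.comp (by fun_prop) hsub

theorem intervalIntegral_eq_rectangleIntegral (hab : a ≤ b) (hL : 0 ≤ L)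
    {f : ℝ × (Fin 2 → ℝ) → ℝ} {t : ℝ}
    (hsub : ∀ x ∈ Icc a b ×ˢ Icc 0 L, (t, pairMap x) ∈ W) (hf : ContinuousOn f W) :
    ∫ s in a..b, ∫ z in (0 : ℝ)..L, f (t, ![s, z]) =
      ∫ x in Icc a b ×ˢ Icc 0 L, f (t, pairMap x) := by
  rw [← intervalIntegral_intervalIntegral_eq_setIntegral hab hL
    (continuousOn_rectangle_slice hsub hf)]
  simp only [pairMap_apply]

end Parametric

theorem hasDerivAt_along {E G : Type*} [NormedAddCommGroup E] [NormedSpace ℝ E]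
    [NormedAddCommGroup G] [NormedSpace ℝ G] {f : E → G} {c : ℝ → E} {v : E} {t : ℝ}
    (hf : DifferentiableAt ℝ f (c t)) (hc : HasDerivAt c v t) :
    HasDerivAt (fun r => f (c r)) (fderiv ℝ f (c t) v) t :=
  hf.hasFDerivAt.comp_hasDerivAt t hc

theorem hasDerivAt_vec_fst (s z : ℝ) :
    HasDerivAt (fun r : ℝ => (![r, z] : Fin 2 → ℝ)) (Pi.single 0 1) s := by
  refine hasDerivAt_pi.2 fun i => ?_
  fin_cases i
  · simpa using hasDerivAt_id' s
  · simpa using hasDerivAt_const s z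

theorem hasDerivAt_vec_snd (s z : ℝ) :
    HasDerivAt (fun r : ℝ => (![s, r] : Fin 2 → ℝ)) (Pi.single 1 1) z := by
  refine hasDerivAt_pi.2 fun i => ?_
  fin_cases i
  · simpa using hasDerivAt_const z s
  · simpa using hasDerivAt_id' z

theorem det_firstFF_metricHR (κ : ℝ) (ψ : (Fin 2 → ℝ) → Fin 3 → ℝ) (q : Fin 2 → ℝ) :
    (firstFF (metricHR κ) ψ q).det =
      conf κ (ψ q 0) (ψ q 1) ^ 2 * (crossProduct (pd 0 ψ q) (pd 1 ψ q) 0 ^ 2 +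
        crossProduct (pd 0 ψ q) (pd 1 ψ q) 1 ^ 2) +
      conf κ (ψ q 0) (ψ q 1) ^ 4 * crossProduct (pd 0 ψ q) (pd 1 ψ q) 2 ^ 2 := by
  rw [Matrix.det_fin_two]
  simp [firstFF, ip_metricHR, cross_apply]
  ring

theorem sqrt_det_metricHR (κ : ℝ) (p : Fin 3 → ℝ) :
    √(metricHR κ p).det = conf κ (p 0) (p 1) ^ 2 := by
  rw [metricHR, Matrix.det_diagonal]
  simp [Fin.prod_univ_three]
  exact Real.sqrt_mul_self (sq_nonneg _)

/-- Cauchy–Schwarz in the two horizontal components. The vertical component of the cross product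
contributes only to the area, since v is horizontal. -/
theorem flux_le_areaDensity {κ : ℝ} {ψ : (Fin 2 → ℝ) → Fin 3 → ℝ} {q : Fin 2 → ℝ}
    {v : Fin 3 → ℝ} (hv : v 0 ^ 2 + v 1 ^ 2 = conf κ (ψ q 0) (ψ q 1) ^ 2) (hv2 : v 2 = 0) :
    v ⬝ᵥ crossProduct (pd 0 ψ q) (pd 1 ψ q) ≤ areaDensity (metricHR κ) ψ q := by
  rw [areaDensity, det_firstFF_metricHR]
  generalize crossProduct (pd 0 ψ q) (pd 1 ψ q) = w
  rw [← hv]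
  apply Real.le_sqrt_of_sq_le
  simp only [dotProduct, Fin.sum_univ_three, hv2]
  nlinarith [sq_nonneg (v 0 * w 1 - v 1 * w 0), sq_nonneg (conf κ (ψ q 0) (ψ q 1) ^ 2 * w 2)]

namespace IsAdmissibleVariation

variable {κ κg : ℝ} {U : Set (Fin 3 → ℝ)} {ψ : (Fin 2 → ℝ) → Fin 3 → ℝ} {I : Set ℝ}
  {L ε a b : ℝ} {Ψ : ℝ → (Fin 2 → ℝ) → Fin 3 → ℝ}

/-- The domain of a variation in time and parameters, restricted to the points mapped to `U`. -/
def domain (U : Set (Fin 3 → ℝ)) (I : Set ℝ) (ε : ℝ) (Ψ : ℝ → (Fin 2 → ℝ) → Fin 3 → ℝ) :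
    Set (ℝ × (Fin 2 → ℝ)) :=
  (Ioo (-ε) ε ×ˢ {q | q 0 ∈ I}) ∩ (fun x => Ψ x.1 x.2) ⁻¹' U

variable (hV : IsAdmissibleVariation U ψ I L ε a b Ψ)
include hV

/-- A variation is smooth for all real z but is known to stay in U only for 0 ≤ z ≤ L. Openness
gives a neighbourhood of the closed rectangle, so that ordinary derivatives can be used on its
edges. -/
theorem isOpen_domain (hI : IsOpen I) (hU : IsOpen U) : IsOpen (domain U I ε Ψ) :=
  hV.smooth.continuousOn.isOpen_inter_preimage (isOpen_Ioo.prod (isOpen_strip hI)) hU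

theorem mem_domain {t : ℝ} (ht : t ∈ Ioo (-ε) ε) {s z : ℝ} (hs : s ∈ I) (hz : z ∈ Icc 0 L) :
    (t, ![s, z]) ∈ domain U I ε Ψ :=
  ⟨⟨ht, hs⟩, hV.mem t ht s hs z hz⟩

theorem pairMap_mem_domain {t : ℝ} (ht : t ∈ Ioo (-ε) ε) {x : ℝ × ℝ}
    (hx : x ∈ Icc a b ×ˢ Icc 0 L) : (t, pairMap x) ∈ domain U I ε Ψ := by
  rw [← Prod.mk.eta (p := x), pairMap_apply]
  exact hV.mem_domain ht (hV.subset hx.1) hx.2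

theorem contDiffAt (hI : IsOpen I) {t : ℝ} (ht : t ∈ Ioo (-ε) ε) {q : Fin 2 → ℝ}
    (hq : q 0 ∈ I) : ContDiffAt ℝ ∞ (fun x : ℝ × (Fin 2 → ℝ) => Ψ x.1 x.2) (t, q) :=
  hV.smooth.contDiffAt ((isOpen_Ioo.prod (isOpen_strip hI)).mem_nhds ⟨ht, hq⟩)

theorem differentiableAt (hI : IsOpen I) {t : ℝ} (ht : t ∈ Ioo (-ε) ε) {q : Fin 2 → ℝ}
    (hq : q 0 ∈ I) : DifferentiableAt ℝ (fun x : ℝ × (Fin 2 → ℝ) => Ψ x.1 x.2) (t, q) :=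
  (hV.contDiffAt hI ht hq).differentiableAt (by simp)

theorem pd_eq (hI : IsOpen I) {t : ℝ} (ht : t ∈ Ioo (-ε) ε) {q : Fin 2 → ℝ}
    (hq : q 0 ∈ I) (i : Fin 2) : pd i (Ψ t) q =
      fderiv ℝ (fun x : ℝ × (Fin 2 → ℝ) => Ψ x.1 x.2) (t, q) (0, Pi.single i 1) := by
  have h : HasFDerivAt (fun q => Ψ t q) _ q :=
    (hV.differentiableAt hI ht hq).hasFDerivAt.comp q (hasFDerivAt_prodMk_right t q)
  rw [pd, h.fderiv]
  simp

theorem hasDerivAt_time (hI : IsOpen I) {t : ℝ} (ht : t ∈ Ioo (-ε) ε) {q : Fin 2 → ℝ}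
    (hq : q 0 ∈ I) : HasDerivAt (fun r => Ψ r q)
      (fderiv ℝ (fun x : ℝ × (Fin 2 → ℝ) => Ψ x.1 x.2) (t, q) (1, 0)) t :=
  hasDerivAt_along (c := fun r => (r, q)) (hV.differentiableAt hI ht hq)
    ((hasDerivAt_id t).prodMk (hasDerivAt_const t q))

theorem hasDerivAt_fst (hI : IsOpen I) {t : ℝ} (ht : t ∈ Ioo (-ε) ε) {s : ℝ} (hs : s ∈ I)
    (z : ℝ) : HasDerivAt (fun r => Ψ t ![r, z]) (pd 0 (Ψ t) ![s, z]) s := by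
  rw [hV.pd_eq hI ht (q := ![s, z]) hs]
  exact hasDerivAt_along (c := fun r => (t, ![r, z])) (hV.differentiableAt hI ht (q := ![s, z]) hs)
    ((hasDerivAt_const s t).prodMk (hasDerivAt_vec_fst s z))

theorem hasDerivAt_snd (hI : IsOpen I) {t : ℝ} (ht : t ∈ Ioo (-ε) ε) {s : ℝ} (hs : s ∈ I)
    (z : ℝ) : HasDerivAt (fun r => Ψ t ![s, r]) (pd 1 (Ψ t) ![s, z]) z := by
  rw [hV.pd_eq hI ht (q := ![s, z]) hs]
  exact hasDerivAt_along (c := fun r => (t, ![s, r])) (hV.differentiableAt hI ht (q := ![s, z]) hs)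
    ((hasDerivAt_const z t).prodMk (hasDerivAt_vec_snd s z))

theorem pd_zero_eq_initial (hI : IsOpen I) (hψ : ∀ q : Fin 2 → ℝ, q 0 ∈ I → DifferentiableAt ℝ ψ q)
    {s z : ℝ} (hs : s ∈ I) (hz : z ∈ Icc 0 L) : pd 0 (Ψ 0) ![s, z] = pd 0 ψ ![s, z] := by
  have h0 : (0 : ℝ) ∈ Ioo (-ε) ε := ⟨by linarith [hV.pos], hV.pos⟩
  have h1 := hV.hasDerivAt_fst hI h0 hs z
  have h2 : HasDerivAt (fun r => ψ ![r, z]) (pd 0 ψ ![s, z]) s :=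
    hasDerivAt_along (c := fun r => ![r, z]) (hψ ![s, z] hs) (hasDerivAt_vec_fst s z)
  refine h1.unique (h2.congr_of_eventuallyEq ?_)
  filter_upwards [hI.mem_nhds hs] with r hr using hV.initial r hr z hz

/-- The maps Ψ 0 and ψ need not agree outside 0 ≤ z ≤ L, so at the edges only one-sided derivatives
can be compared. They determine the full ones. -/
theorem pd_one_eq_initial (hI : IsOpen I) (hψ : ∀ q : Fin 2 → ℝ, q 0 ∈ I → DifferentiableAt ℝ ψ q)
    (hL : 0 < L) {s z : ℝ} (hs : s ∈ I) (hz : z ∈ Icc 0 L) :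
    pd 1 (Ψ 0) ![s, z] = pd 1 ψ ![s, z] := by
  have h0 : (0 : ℝ) ∈ Ioo (-ε) ε := ⟨by linarith [hV.pos], hV.pos⟩
  have h1 := (hV.hasDerivAt_snd hI h0 hs z).hasDerivWithinAt (s := Icc 0 L)
  have h2 : HasDerivAt (fun r => ψ ![s, r]) (pd 1 ψ ![s, z]) z :=
    hasDerivAt_along (c := fun r => ![s, r]) (hψ ![s, z] hs) (hasDerivAt_vec_snd s z)
  have h3 := h2.hasDerivWithinAt (s := Icc 0 L)
  exact (uniqueDiffOn_Icc hL z hz).eq_deriv _ h1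
    (h3.congr (fun r hr => hV.initial s hs r hr) (hV.initial s hs z hz))

theorem time_deriv_edge_eq_zero (hI : IsOpen I) {t : ℝ} (ht : t ∈ Ioo (-ε) ε) {s c : ℝ}
    (hs : s ∈ I) {e : ℝ} (hc : ∀ t ∈ Ioo (-ε) ε, ∀ s ∈ I, Ψ t ![s, c] 2 = e) :
    fderiv ℝ (fun x : ℝ × (Fin 2 → ℝ) => Ψ x.1 x.2) (t, ![s, c]) (1, 0) 2 = 0 := by
  have h1 := hasDerivAt_pi.1 (hV.hasDerivAt_time hI ht (q := ![s, c]) hs) 2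
  refine h1.unique ((hasDerivAt_const t e).congr_of_eventuallyEq ?_)
  filter_upwards [isOpen_Ioo.mem_nhds ht] with r hr using hc r hr s hs

theorem pd_zero_edge_eq_zero (hI : IsOpen I) {t : ℝ} (ht : t ∈ Ioo (-ε) ε) {s c : ℝ}
    (hs : s ∈ I) {e : ℝ} (hc : ∀ t ∈ Ioo (-ε) ε, ∀ s ∈ I, Ψ t ![s, c] 2 = e) :
    fderiv ℝ (fun x : ℝ × (Fin 2 → ℝ) => Ψ x.1 x.2) (t, ![s, c]) (0, Pi.single 0 1) 2 = 0 := by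
  have h1 := hasDerivAt_pi.1 (hV.hasDerivAt_fst hI ht hs c) 2
  rw [← hV.pd_eq hI ht (q := ![s, c]) hs]
  refine h1.unique ((hasDerivAt_const s e).congr_of_eventuallyEq ?_)
  filter_upwards [hI.mem_nhds hs] with r hr using hc t ht r hr

/-- Points with s = a or s = b are limits of points that do not move, hence do not move either. -/
theorem time_deriv_side_eq_zero (hI : IsOpen I)
    (hψ : ∀ q : Fin 2 → ℝ, q 0 ∈ I → DifferentiableAt ℝ ψ q) {t : ℝ}
    (ht : t ∈ Ioo (-ε) ε) {s z : ℝ} (hs : s = a ∨ s = b) (hz : z ∈ Icc 0 L) :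
    fderiv ℝ (fun x : ℝ × (Fin 2 → ℝ) => Ψ x.1 x.2) (t, ![s, z]) (1, 0) = 0 := by
  have hsI : s ∈ I := by
    rcases hs with rfl | rfl
    · exact hV.subset ⟨le_rfl, hV.le⟩
    · exact hV.subset ⟨hV.le, le_rfl⟩
  have h1 := hV.hasDerivAt_time hI ht (q := ![s, z]) hsI
  refine h1.unique ((hasDerivAt_const t (ψ ![s, z])).congr_of_eventuallyEq ?_)
  filter_upwards [isOpen_Ioo.mem_nhds ht] with r hr
  ext k
  have hcont : ContinuousOn (fun s => Ψ r ![s, z] k - ψ ![s, z] k) I := fun s hs =>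
    (((hasDerivAt_pi.1 (hV.hasDerivAt_fst hI hr hs z) k).continuousAt).sub
      (hasDerivAt_pi.1 (hasDerivAt_along (c := fun r => ![r, z]) (hψ ![s, z] hs)
        (hasDerivAt_vec_fst s z)) k).continuousAt).continuousWithinAt
  exact sub_eq_zero.1 (eq_zero_of_mem_closure_outside hI hcont
    (fun s hs hs' => by simp [hV.support r hr s hs hs' z hz]) hsI hs)

end IsAdmissibleVariation

/-! ### Flux of the calibration through the moving surface -/

section Flux

variable {κ κg : ℝ} {ψ : (Fin 2 → ℝ) → Fin 3 → ℝ} {I : Set ℝ}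
  {L ε a b : ℝ} {Ψ : ℝ → (Fin 2 → ℝ) → Fin 3 → ℝ} {X : (Fin 3 → ℝ) → Fin 3 → ℝ}

/-- The mixed product of a field with the derivatives of a variation in two directions. -/
def mixedProduct (X : (Fin 3 → ℝ) → Fin 3 → ℝ) (Ψ : ℝ → (Fin 2 → ℝ) → Fin 3 → ℝ)
    (v w : ℝ × (Fin 2 → ℝ)) (x : ℝ × (Fin 2 → ℝ)) : ℝ :=
  X (Ψ x.1 x.2) ⬝ᵥ crossProduct (fderiv ℝ (fun x : ℝ × (Fin 2 → ℝ) => Ψ x.1 x.2) x v)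
    (fderiv ℝ (fun x : ℝ × (Fin 2 → ℝ) => Ψ x.1 x.2) x w)

/-- The density of the swept volume. -/
def volumeDensity (κ : ℝ) (Ψ : ℝ → (Fin 2 → ℝ) → Fin 3 → ℝ) (x : ℝ × (Fin 2 → ℝ)) : ℝ :=
  conf κ (Ψ x.1 x.2 0) (Ψ x.1 x.2 1) ^ 2 *
    (fderiv ℝ (fun x : ℝ × (Fin 2 → ℝ) => Ψ x.1 x.2) x (1, 0) ⬝ᵥ
      crossProduct (fderiv ℝ (fun x : ℝ × (Fin 2 → ℝ) => Ψ x.1 x.2) x (0, Pi.single 0 1))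
        (fderiv ℝ (fun x : ℝ × (Fin 2 → ℝ) => Ψ x.1 x.2) x (0, Pi.single 1 1)))

theorem contDiffAt_tripleProduct {E : Type*} [NormedAddCommGroup E] [NormedSpace ℝ E]
    {n : WithTop ℕ∞} {A B C : E → Fin 3 → ℝ} {x : E} (hA : ContDiffAt ℝ n A x)
    (hB : ContDiffAt ℝ n B x) (hC : ContDiffAt ℝ n C x) :
    ContDiffAt ℝ n (fun y => A y ⬝ᵥ crossProduct (B y) (C y)) x := by
  have hA' := contDiffAt_pi.1 hA
  have hB' := contDiffAt_pi.1 hB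
  have hC' := contDiffAt_pi.1 hC
  have heq : (fun y => A y ⬝ᵥ crossProduct (B y) (C y)) = fun y =>
      A y 0 * (B y 1 * C y 2 - B y 2 * C y 1) + A y 1 * (B y 2 * C y 0 - B y 0 * C y 2) +
        A y 2 * (B y 0 * C y 1 - B y 1 * C y 0) := by
    funext y
    simp [cross_apply, dotProduct, Fin.sum_univ_three]
  rw [heq]
  exact (((hA' 0).mul (((hB' 1).mul (hC' 2)).sub ((hB' 2).mul (hC' 1)))).add
    ((hA' 1).mul (((hB' 2).mul (hC' 0)).sub ((hB' 0).mul (hC' 2))))).add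
    ((hA' 2).mul (((hB' 0).mul (hC' 1)).sub ((hB' 1).mul (hC' 0))))

variable (hV : IsAdmissibleVariation (space κ) ψ I L ε a b Ψ)
include hV

theorem contDiffAt_fderiv_variation (hI : IsOpen I) {x : ℝ × (Fin 2 → ℝ)}
    (hx : x ∈ IsAdmissibleVariation.domain (space κ) I ε Ψ) (v : ℝ × (Fin 2 → ℝ)) :
    ContDiffAt ℝ ∞ (fun y => fderiv ℝ (fun x : ℝ × (Fin 2 → ℝ) => Ψ x.1 x.2) y v) x :=
  ((hV.contDiffAt hI hx.1.1 hx.1.2).fderiv_right (m := ∞) (by simp)).clm_apply contDiffAt_const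

theorem contDiffOn_mixedProduct (hI : IsOpen I)
    (hX : ∀ P ∈ space κ, ContDiffAt ℝ ∞ X P) (v w : ℝ × (Fin 2 → ℝ)) :
    ContDiffOn ℝ ∞ (mixedProduct X Ψ v w) (IsAdmissibleVariation.domain (space κ) I ε Ψ) :=
  fun x hx => (contDiffAt_tripleProduct
    (ContDiffAt.comp x (hX _ hx.2) (hV.contDiffAt hI hx.1.1 hx.1.2))
    (contDiffAt_fderiv_variation hV hI hx v)
    (contDiffAt_fderiv_variation hV hI hx w)).contDiffWithinAt

theorem contDiffAt_conf_variation (hκ : κ < 0) (hI : IsOpen I) {x : ℝ × (Fin 2 → ℝ)}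
    (hx : x ∈ IsAdmissibleVariation.domain (space κ) I ε Ψ) :
    ContDiffAt ℝ ∞ (fun x : ℝ × (Fin 2 → ℝ) => conf κ (Ψ x.1 x.2 0) (Ψ x.1 x.2 1)) x := by
  have h := contDiffAt_pi.1 (hV.contDiffAt hI hx.1.1 hx.1.2)
  exact contDiffAt_conf (h 0) (h 1) (space_denom_pos hκ hx.2)

theorem contDiffOn_volumeDensity (hκ : κ < 0) (hI : IsOpen I) :
    ContDiffOn ℝ ∞ (volumeDensity κ Ψ) (IsAdmissibleVariation.domain (space κ) I ε Ψ) :=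
  fun _ hx => (((contDiffAt_conf_variation hV hκ hI hx).pow 2).mul (contDiffAt_tripleProduct
    (contDiffAt_fderiv_variation hV hI hx _) (contDiffAt_fderiv_variation hV hI hx _)
    (contDiffAt_fderiv_variation hV hI hx _))).contDiffWithinAt

theorem contDiffOn_det_firstFF (hκ : κ < 0) (hI : IsOpen I) :
    ContDiffOn ℝ ∞ (fun x => (firstFF (metricHR κ) (Ψ x.1) x.2).det)
      (IsAdmissibleVariation.domain (space κ) I ε Ψ) := by
  intro x hx
  have hσ := contDiffAt_conf_variation hV hκ hI hx
  have h0 := contDiffAt_pi.1 (contDiffAt_fderiv_variation hV hI hx (0, Pi.single 0 1))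
  have h1 := contDiffAt_pi.1 (contDiffAt_fderiv_variation hV hI hx (0, Pi.single 1 1))
  have key := ((hσ.pow 2).mul (((((h0 1).mul (h1 2)).sub ((h0 2).mul (h1 1))).pow 2).add
    ((((h0 2).mul (h1 0)).sub ((h0 0).mul (h1 2))).pow 2))).add ((hσ.pow 4).mul
      ((((h0 0).mul (h1 1)).sub ((h0 1).mul (h1 0))).pow 2))
  refine key.contDiffWithinAt.congr (fun y hy => ?_) ?_
  · rw [det_firstFF_metricHR, hV.pd_eq hI hy.1.1 hy.1.2, hV.pd_eq hI hy.1.1 hy.1.2]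
    simp [cross_apply]
  · rw [det_firstFF_metricHR, hV.pd_eq hI hx.1.1 hx.1.2, hV.pd_eq hI hx.1.1 hx.1.2]
    simp [cross_apply]

/-- For t ≠ 0 the surface may degenerate and the square root lose smoothness, so only continuity is
claimed on the whole domain. -/
theorem continuousOn_areaDensity (hκ : κ < 0) (hI : IsOpen I) :
    ContinuousOn (fun x : ℝ × (Fin 2 → ℝ) => areaDensity (metricHR κ) (Ψ x.1) x.2)
      (IsAdmissibleVariation.domain (space κ) I ε Ψ) :=
  (contDiffOn_det_firstFF hV hκ hI).continuousOn.sqrt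

theorem sweptVolume_eq (hκ : κ < 0) (hI : IsOpen I) (hL : 0 < L) {t : ℝ}
    (ht : t ∈ Ioo (-ε) ε) : sweptVolume (metricHR κ) Ψ L a b t =
      ∫ r in (0 : ℝ)..t, ∫ x in Icc a b ×ˢ Icc 0 L, volumeDensity κ Ψ (r, pairMap x) := by
  have h0 : (0 : ℝ) ∈ Ioo (-ε) ε := ⟨by linarith [hV.pos], hV.pos⟩
  refine intervalIntegral.integral_congr fun r hr => ?_
  have hr' : r ∈ Ioo (-ε) ε := ordConnected_Ioo.uIcc_subset h0 ht hr
  refine Eq.trans ?_ (intervalIntegral_eq_rectangleIntegral hV.le hL.le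
    (fun x hx => hV.pairMap_mem_domain hr' hx) (contDiffOn_volumeDensity hV hκ hI).continuousOn)
  refine intervalIntegral.integral_congr fun s hs => ?_
  rw [uIcc_of_le hV.le] at hs
  have hsI := hV.subset hs
  refine intervalIntegral.integral_congr fun z _ => ?_
  simp only [volumeDensity]
  rw [sqrt_det_metricHR, hV.pd_eq hI hr' (q := ![s, z]) hsI, hV.pd_eq hI hr' (q := ![s, z]) hsI,
    (hV.hasDerivAt_time hI hr' (q := ![s, z]) hsI).deriv]

theorem contDiffOn_sweptVolume (hκ : κ < 0) (hI : IsOpen I) (hL : 0 < L) :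
    ContDiffOn ℝ 2 (sweptVolume (metricHR κ) Ψ L a b) (Ioo (-ε) ε) := by
  have h := contDiffOn_rectangleIntegral (a := a) (b := b) (L := L) 1 isOpen_Ioo
    (hV.isOpen_domain hI (isOpen_space κ)) (fun t ht x hx => hV.pairMap_mem_domain ht hx)
    ((contDiffOn_volumeDensity hV hκ hI).of_le (by exact_mod_cast le_top))
  exact (contDiffOn_primitive 1 hV.pos h).congr fun t ht => sweptVolume_eq hV hκ hI hL ht

theorem area_eq (hκ : κ < 0) (hI : IsOpen I) (hL : 0 < L) {t : ℝ} (ht : t ∈ Ioo (-ε) ε) :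
    area (metricHR κ) (Ψ t) L a b =
      ∫ x in Icc a b ×ˢ Icc 0 L, areaDensity (metricHR κ) (Ψ t) (pairMap x) :=
  intervalIntegral_eq_rectangleIntegral
    (f := fun x : ℝ × (Fin 2 → ℝ) => areaDensity (metricHR κ) (Ψ x.1) x.2) hV.le hL.le
    (fun _ hx => hV.pairMap_mem_domain ht hx) (continuousOn_areaDensity hV hκ hI)

/-- The determinant is positive on the compact rectangle at t = 0. The tube lemma keeps it positive
for t near 0, where the square root is then smooth. -/
theorem contDiffAt_area (hκ : κ < 0) (hI : IsOpen I) (hL : 0 < L)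
    (hpos : ∀ x ∈ Icc a b ×ˢ Icc 0 L, 0 < (firstFF (metricHR κ) (Ψ 0) (pairMap x)).det) :
    ContDiffAt ℝ 2 (fun t => area (metricHR κ) (Ψ t) L a b) 0 := by
  have h0 : (0 : ℝ) ∈ Ioo (-ε) ε := ⟨by linarith [hV.pos], hV.pos⟩
  have hdet := contDiffOn_det_firstFF hV hκ hI
  have hopen : IsOpen (IsAdmissibleVariation.domain (space κ) I ε Ψ ∩
      (fun x => (firstFF (metricHR κ) (Ψ x.1) x.2).det) ⁻¹' Ioi 0) :=
    hdet.continuousOn.isOpen_inter_preimage (hV.isOpen_domain hI (isOpen_space κ)) isOpen_Ioi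
  obtain ⟨T, O, hT, -, h0T, hKO, hTO⟩ := generalized_tube_lemma (isCompact_singleton (x := (0 : ℝ)))
    (isCompact_Icc.prod isCompact_Icc) (hopen.preimage timePairMap.continuous)
    (s := {0}) (t := Icc a b ×ˢ Icc 0 L) (by
      rintro ⟨t, x⟩ ⟨ht, hx⟩
      rw [mem_singleton_iff] at ht
      subst ht
      exact ⟨hV.pairMap_mem_domain h0 hx, hpos x hx⟩)
  have hTopen : IsOpen (T ∩ Ioo (-ε) ε) := hT.inter isOpen_Ioo
  have h := contDiffOn_rectangleIntegral (a := a) (b := b) (L := L)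
    (f := fun x : ℝ × (Fin 2 → ℝ) => areaDensity (metricHR κ) (Ψ x.1) x.2) 2 hTopen hopen
    (fun t ht x hx => hTO (mk_mem_prod ht.1 (hKO hx)))
    (contDiffOn_infty.1 ((hdet.mono inter_subset_left).sqrt
      fun x hx => ne_of_gt (mem_Ioi.1 (mem_preimage.1 hx.2))) 2)
  exact (h.congr fun t ht => area_eq hV hκ hI hL ht.2).contDiffAt
    (hTopen.mem_nhds ⟨h0T rfl, h0⟩)

/-- `divergence_pullback` in the directions t, s, z expresses the time derivative of the flux
density as κ_g times the volume density minus a divergence in (s, z). That divergence integrates to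
zero: the velocity vanishes on the sides, and on the edges the field, the velocity and the edge
tangent are all horizontal. -/
theorem hasDerivAt_flux (hκ : κ < 0) (hI : IsOpen I) (hL : 0 < L)
    (hψ : ∀ q : Fin 2 → ℝ, q 0 ∈ I → DifferentiableAt ℝ ψ q)
    (hX : ∀ P ∈ space κ, ContDiffAt ℝ ∞ X P) (hX2 : ∀ P, X P 2 = 0)
    (hdiv : ∀ P ∈ space κ, ∑ i, fderiv ℝ X P (Pi.single i 1) i = κg * conf κ (P 0) (P 1) ^ 2)
    {t : ℝ} (ht : t ∈ Ioo (-ε) ε) :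
    HasDerivAt (fun t => ∫ x in Icc a b ×ˢ Icc 0 L,
        mixedProduct X Ψ (0, Pi.single 0 1) (0, Pi.single 1 1) (t, pairMap x))
      (κg * ∫ x in Icc a b ×ˢ Icc 0 L, volumeDensity κ Ψ (t, pairMap x)) t := by
  have hW := hV.isOpen_domain hI (isOpen_space κ)
  have hsm : ∀ v w, ContDiffOn ℝ 1 (mixedProduct X Ψ v w)
      (IsAdmissibleVariation.domain (space κ) I ε Ψ) := fun v w =>
    (contDiffOn_mixedProduct hV hI hX v w).of_le (by exact_mod_cast le_top)
  refine (hasDerivAt_rectangleIntegral isOpen_Ioo hW (fun t ht x hx => hV.pairMap_mem_domain ht hx)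
    (hsm _ _) ht).congr_deriv ?_
  set es : ℝ × (Fin 2 → ℝ) := (0, Pi.single 0 1) with hes
  set ez : ℝ × (Fin 2 → ℝ) := (0, Pi.single 1 1) with hez
  set et : ℝ × (Fin 2 → ℝ) := (1, 0) with het
  set O : Set (Fin 2 → ℝ) := {q | (t, q) ∈ IsAdmissibleVariation.domain (space κ) I ε Ψ} with hOdef
  have hO : IsOpen O := hW.preimage (by fun_prop)
  have hmaps : MapsTo pairMap (Icc a b ×ˢ Icc 0 L) O := fun x hx => hV.pairMap_mem_domain ht hx
  have hslice : ∀ v w, ContDiffOn ℝ 1 (fun q => mixedProduct X Ψ v w (t, q)) O := fun v w =>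
    (hsm v w).comp (contDiff_prodMk_right t).contDiffOn fun q hq => hq
  have hpd : ∀ v w, ∀ q ∈ O, ∀ i : Fin 2, pd i (fun q => mixedProduct X Ψ v w (t, q)) q =
      fderiv ℝ (mixedProduct X Ψ v w) (t, q) (0, Pi.single i 1) := by
    intro v w q hq i
    have h : HasFDerivAt (fun q => mixedProduct X Ψ v w (t, q)) _ q :=
      (((hsm v w).contDiffAt (hW.mem_nhds hq)).differentiableAt one_ne_zero).hasFDerivAt.comp q
        (hasFDerivAt_prodMk_right t q)
    rw [pd, h.fderiv]
    simp
  have hpoint : ∀ q ∈ O, fderiv ℝ (mixedProduct X Ψ es ez) (t, q) et =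
      κg * volumeDensity κ Ψ (t, q) -
        (pd 0 (fun q => mixedProduct X Ψ ez et (t, q)) q +
          pd 1 (fun q => mixedProduct X Ψ et es (t, q)) q) := by
    intro q hq
    have h := divergence_pullback (Y := X) (f := fun x : ℝ × (Fin 2 → ℝ) => Ψ x.1 x.2)
      (x := (t, q))
      (by exact_mod_cast contDiffAt_infty.1 (hV.contDiffAt hI hq.1.1 hq.1.2) 2)
      ((hX _ hq.2).differentiableAt (by simp)) et es ez
    rw [hdiv _ hq.2] at h
    rw [hpd _ _ q hq, hpd _ _ q hq, volumeDensity]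
    simp only [← hes, ← hez, ← het]
    change _ + fderiv ℝ (mixedProduct X Ψ ez et) (t, q) es +
      fderiv ℝ (mixedProduct X Ψ et es) (t, q) ez = _ at h
    change fderiv ℝ (mixedProduct X Ψ es ez) (t, q) et + _ + _ = _ at h
    linarith
  have hK : IsCompact (Icc a b ×ˢ Icc 0 L) := isCompact_Icc.prod isCompact_Icc
  rw [setIntegral_congr_fun hK.measurableSet fun x hx => hpoint _ (hmaps hx)]
  have hint1 : IntegrableOn (fun x => κg * volumeDensity κ Ψ (t, pairMap x))
      (Icc a b ×ˢ Icc 0 L) :=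
    (continuousOn_const.mul (continuousOn_rectangle_slice
      (fun x hx => hV.pairMap_mem_domain ht hx)
      (contDiffOn_volumeDensity hV hκ hI).continuousOn)).integrableOn_compact hK
  have hint2 : IntegrableOn (fun x => pd 0 (fun q => mixedProduct X Ψ ez et (t, q)) (pairMap x) +
      pd 1 (fun q => mixedProduct X Ψ et es (t, q)) (pairMap x)) (Icc a b ×ˢ Icc 0 L) :=
    (((contDiffOn_pd hO (hslice ez et) (m := 0) (by simp) 0).continuousOn.add
      (contDiffOn_pd hO (hslice et es) (m := 0) (by simp) 1).continuousOn).comp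
      pairMap.continuous.continuousOn hmaps).integrableOn_compact hK
  have hside : ∀ s, (s = a ∨ s = b) →
      ∫ z in (0 : ℝ)..L, mixedProduct X Ψ ez et (t, ![s, z]) = 0 := by
    intro s hs
    rw [intervalIntegral.integral_congr (g := fun _ => 0), intervalIntegral.integral_zero]
    intro z hz
    rw [uIcc_of_le hL.le] at hz
    simp only [mixedProduct]
    rw [hV.time_deriv_side_eq_zero hI hψ ht hs hz]
    simp
  -- Three horizontal vectors have zero mixed product.
  have hedge : ∀ c e, (∀ t ∈ Ioo (-ε) ε, ∀ s ∈ I, Ψ t ![s, c] 2 = e) →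
      ∫ s in a..b, mixedProduct X Ψ et es (t, ![s, c]) = 0 := by
    intro c e hc
    rw [intervalIntegral.integral_congr (g := fun _ => 0), intervalIntegral.integral_zero]
    intro s hs
    rw [uIcc_of_le hV.le] at hs
    have h1 := hV.time_deriv_edge_eq_zero hI ht (hV.subset hs) hc
    have h2 := hV.pd_zero_edge_eq_zero hI ht (hV.subset hs) hc
    simp only [mixedProduct, dotProduct, Fin.sum_univ_three, cross_apply, hX2]
    simp [het, hes, h1, h2]
  rw [integral_sub hint1 hint2, integral_const_mul,
    integral_rectangle_divergence hO hV.le hL.le hmaps (hslice ez et) (hslice et es),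
    hside a (Or.inl rfl), hside b (Or.inr rfl), hedge 0 0 hV.bottom, hedge L L hV.top]
  ring

theorem flux_eq (hκ : κ < 0) (hI : IsOpen I) (hL : 0 < L)
    (hψ : ∀ q : Fin 2 → ℝ, q 0 ∈ I → DifferentiableAt ℝ ψ q)
    (hX : ∀ P ∈ space κ, ContDiffAt ℝ ∞ X P) (hX2 : ∀ P, X P 2 = 0)
    (hdiv : ∀ P ∈ space κ, ∑ i, fderiv ℝ X P (Pi.single i 1) i = κg * conf κ (P 0) (P 1) ^ 2)
    {t : ℝ} (ht : t ∈ Ioo (-ε) ε) :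
    ∫ x in Icc a b ×ˢ Icc 0 L,
        mixedProduct X Ψ (0, Pi.single 0 1) (0, Pi.single 1 1) (t, pairMap x) =
      (∫ x in Icc a b ×ˢ Icc 0 L,
        mixedProduct X Ψ (0, Pi.single 0 1) (0, Pi.single 1 1) (0, pairMap x)) +
      κg * sweptVolume (metricHR κ) Ψ L a b t := by
  have h0 : (0 : ℝ) ∈ Ioo (-ε) ε := ⟨by linarith [hV.pos], hV.pos⟩
  have hsub : uIcc 0 t ⊆ Ioo (-ε) ε := ordConnected_Ioo.uIcc_subset h0 ht
  have hc : ContinuousOn (fun r => ∫ x in Icc a b ×ˢ Icc 0 L, volumeDensity κ Ψ (r, pairMap x))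
      (Ioo (-ε) ε) :=
    (contDiffOn_rectangleIntegral (a := a) (b := b) (L := L) 1 isOpen_Ioo
      (hV.isOpen_domain hI (isOpen_space κ)) (fun t ht x hx => hV.pairMap_mem_domain ht hx)
      ((contDiffOn_volumeDensity hV hκ hI).of_le (by exact_mod_cast le_top))).continuousOn
  have h := intervalIntegral.integral_eq_sub_of_hasDerivAt
    (fun r hr => hasDerivAt_flux hV hκ hI hL hψ hX hX2 hdiv (hsub hr))
    ((continuousOn_const.mul (hc.mono hsub)).intervalIntegrable)
  rw [intervalIntegral.integral_const_mul] at h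
  rw [sweptVolume_eq hV hκ hI hL ht]
  linarith

end Flux

/-- The calibration inequality makes J(0) minimal on the whole interval |t| < ε. The derivative
conditions follow from this, and no second variation formula is used. -/
theorem variation_stable {κ κg : ℝ} {I : Set ℝ} {α : ℝ → Fin 2 → ℝ} {L ε a b : ℝ}
    {Ψ : ℝ → (Fin 2 → ℝ) → Fin 3 → ℝ} (hκ : κ < 0) (hκg : κg ^ 2 + κ ≤ 0) (hI : IsOpen I)
    (hI' : I.OrdConnected) (hα : ContDiffOn ℝ ∞ α I) (hmem : ∀ s ∈ I, α s ∈ disk κ)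
    (hreg : ∀ s ∈ I, deriv α s ≠ 0) (hcurv : ∀ s ∈ I, geodesicCurvature κ α s = κg)
    (hL : 0 < L) (hV : IsAdmissibleVariation (space κ) (cylinder α) I L ε a b Ψ) :
    ContDiffAt ℝ 2 (constrainedEnergy (metricHR κ) Ψ L (-κg / 2) (Real.pi / 2) a b) 0 ∧
      deriv (constrainedEnergy (metricHR κ) Ψ L (-κg / 2) (Real.pi / 2) a b) 0 = 0 ∧
      0 ≤ deriv (deriv (constrainedEnergy (metricHR κ) Ψ L (-κg / 2) (Real.pi / 2) a b)) 0 := by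
  have h0 : (0 : ℝ) ∈ Ioo (-ε) ε := ⟨by linarith [hV.pos], hV.pos⟩
  have hψ : ∀ q : Fin 2 → ℝ, q 0 ∈ I → DifferentiableAt ℝ (cylinder α) q := fun q hq =>
    (hasFDerivAt_cylinder (hasDerivAt_of_contDiffOn hI hα hq)).differentiableAt
  obtain ⟨X, hX, hXn, hX2, hdiv, hXα⟩ := exists_calibration hκ hκg hI hI' hα hmem hreg hcurv
    ⟨a, hV.subset ⟨le_rfl, hV.le⟩⟩
  have hK : IsCompact (Icc a b ×ˢ Icc 0 L) := isCompact_Icc.prod isCompact_Icc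
  have hJ : constrainedEnergy (metricHR κ) Ψ L (-κg / 2) (Real.pi / 2) a b = fun t =>
      area (metricHR κ) (Ψ t) L a b - κg * sweptVolume (metricHR κ) Ψ L a b t := by
    funext t
    rw [constrainedEnergy, energy, Real.cos_pi_div_two]
    ring
  have hpd : ∀ (i : Fin 2), ∀ x ∈ Icc a b ×ˢ Icc 0 L, pd i (Ψ 0) (pairMap x) =
      pd i (cylinder α) (pairMap x) := by
    rintro i ⟨s, z⟩ ⟨hs, hz⟩
    rw [pairMap_apply]
    fin_cases i
    · exact hV.pd_zero_eq_initial hI hψ (hV.subset hs) hz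
    · exact hV.pd_one_eq_initial hI hψ hL (hV.subset hs) hz
  have hinit : ∀ x ∈ Icc a b ×ˢ Icc 0 L, Ψ 0 (pairMap x) = cylinder α (pairMap x) := by
    rintro ⟨s, z⟩ ⟨hs, hz⟩
    rw [pairMap_apply]
    exact hV.initial s (hV.subset hs) z hz
  have hmemI : ∀ x ∈ Icc a b ×ˢ Icc 0 L, pairMap x 0 ∈ I := fun x hx => hV.subset hx.1
  have hff : ∀ x ∈ Icc a b ×ˢ Icc 0 L, firstFF (metricHR κ) (Ψ 0) (pairMap x) =
      firstFF (metricHR κ) (cylinder α) (pairMap x) := by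
    intro x hx
    simp only [firstFF, hpd _ x hx, hinit x hx]
  have hsp : ∀ x ∈ Icc a b ×ˢ Icc 0 L, 0 < speed κ α (pairMap x 0) := fun x hx =>
    speed_pos hκ (hmem _ (hmemI x hx)) (hreg _ (hmemI x hx))
  have hpos : ∀ x ∈ Icc a b ×ˢ Icc 0 L,
      0 < (firstFF (metricHR κ) (Ψ 0) (pairMap x)).det := by
    intro x hx
    have := hsp x hx
    rw [hff x hx, firstFF_cylinder hI hα (hmemI x hx), Matrix.det_diagonal]
    simp only [Fin.prod_univ_two, Matrix.cons_val_zero, Matrix.cons_val_one]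
    positivity
  have hC2 : ContDiffAt ℝ 2
      (constrainedEnergy (metricHR κ) Ψ L (-κg / 2) (Real.pi / 2) a b) 0 := by
    rw [hJ]
    exact (contDiffAt_area hV hκ hI hL hpos).sub (contDiffAt_const.mul
      ((contDiffOn_sweptVolume hV hκ hI hL).contDiffAt (isOpen_Ioo.mem_nhds h0)))
  have hle : ∀ t ∈ Ioo (-ε) ε, ∫ x in Icc a b ×ˢ Icc 0 L,
      mixedProduct X Ψ (0, Pi.single 0 1) (0, Pi.single 1 1) (t, pairMap x) ≤
      area (metricHR κ) (Ψ t) L a b := by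
    intro t ht
    rw [area_eq hV hκ hI hL ht]
    have hsub : ∀ x ∈ Icc a b ×ˢ Icc 0 L, (t, pairMap x) ∈
      IsAdmissibleVariation.domain (space κ) I ε Ψ := fun x hx => hV.pairMap_mem_domain ht hx
    refine setIntegral_mono_on
      ((continuousOn_rectangle_slice hsub
        (contDiffOn_mixedProduct hV hI hX _ _).continuousOn).integrableOn_compact hK)
      ((continuousOn_rectangle_slice hsub
        (continuousOn_areaDensity hV hκ hI)).integrableOn_compact hK)
      hK.measurableSet fun x hx => ?_
    rw [mixedProduct, ← hV.pd_eq hI ht (hmemI x hx), ← hV.pd_eq hI ht (hmemI x hx)]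
    exact flux_le_areaDensity (hXn _ (hsub x hx).2) (hX2 _)
  -- Along the cylinder the field is σ² times the unit normal, so flux and area densities coincide.
  have heq : ∫ x in Icc a b ×ˢ Icc 0 L,
      mixedProduct X Ψ (0, Pi.single 0 1) (0, Pi.single 1 1) (0, pairMap x) =
      area (metricHR κ) (Ψ 0) L a b := by
    rw [area_eq hV hκ hI hL h0]
    refine setIntegral_congr_fun hK.measurableSet fun x hx => ?_
    have hq := hmemI x hx
    simp only [mixedProduct]
    rw [← hV.pd_eq hI h0 hq, ← hV.pd_eq hI h0 hq, hpd 0 x hx, hpd 1 x hx, areaDensity, hff x hx,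
      ← areaDensity, areaDensity_cylinder hκ hI hα hq (hmem _ hq) (hreg _ hq), hinit x hx,
      pd_zero_cylinder hI hα hq, pd_one_cylinder hI hα hq, ← hXα _ hq]
    simp [dotProduct, Fin.sum_univ_three, cross_apply]
    ring
  -- The flux minus κ_g times the swept volume is constant in t, lies below J, and equals J at t =
  -- 0.
  have hmin : IsLocalMin (constrainedEnergy (metricHR κ) Ψ L (-κg / 2) (Real.pi / 2) a b) 0 := by
    filter_upwards [isOpen_Ioo.mem_nhds h0] with t ht
    have h1 := flux_eq hV hκ hI hL hψ hX hX2 hdiv ht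
    have h2 := hle t ht
    have h3 : sweptVolume (metricHR κ) Ψ L a b 0 = 0 := intervalIntegral.integral_same
    simp only [hJ, h3]
    linarith
  exact ⟨hC2, hmin.deriv_eq_zero, deriv_deriv_nonneg_of_isLocalMin hmin hC2.continuousAt⟩

end

end Partitioning

theorem theorem5p1 (κ κg : ℝ) (hκ : κ < 0) (hκg : κg ^ 2 + κ ≤ 0)
    (I : Set ℝ) (hI : IsOpen I) (hI' : I.OrdConnected)
    (α : ℝ → Fin 2 → ℝ) (hα : ContDiffOn ℝ ∞ α I)
    (hmem : ∀ s ∈ I, α s ∈ Partitioning.disk κ)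
    (hreg : ∀ s ∈ I, deriv α s ≠ 0)
    (hcurv : ∀ s ∈ I, Partitioning.geodesicCurvature κ α s = κg)
    (L : ℝ) (hL : 0 < L) :
    Partitioning.IsStronglyStable (Partitioning.space κ) (Partitioning.metricHR κ)
      (Partitioning.cylinder α) I L :=
  -- The sign of H comes from the normal lying to the right of α'; the angle is right because this
  -- normal is horizontal.
  ⟨-κg / 2, Real.pi / 2, Partitioning.isCapillary_cylinder hκ hI hα hmem hreg hcurv,
    fun _ _ _ _ hV => Partitioning.variation_stable hκ hκg hI hI' hα hmem hreg hcurv hL hV,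
    fun _ hu =>
      Partitioning.secondVariation_cylinder_nonneg hκ hκg hI hα hmem hreg hcurv hL hu⟩
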